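/- Let $n,m\ge 1$ and let $\boldsymbol{k}=(k_1,\dots,k_m)$ be integers with $1\le k_i\le n$. Write $\Lambda^{k}=\Lambda^{k}(\mathbb{R}^n)$ for the space of alternating $k$-linear maps $(\mathbb{R}^n)^k\to\mathbb{R}$ and $\boldsymbol{\Lambda^k}=\prod_{i=1}^m\Lambda^{k_i}$. For a multi-index $\alpha=(\alpha_1,\dots,\alpha_m)$ of integers with $0\le\alpha_i\le\lfloor n/k_i\rfloor$, put $|\boldsymbol{k}\alpha|=\sum_i k_i\alpha_i$, and for $\boldsymbol{\xi}=(\xi_1,\dots,\xi_m)\in\boldsymbol{\Lambda^k}$ put $$\boldsymbol{\xi}^{\alpha}=\underbrace{\xi_1\wedge\dots\wedge\xi_1}_{\alpha_1}\wedge\dots\wedge\underbrace{\xi_m\wedge\dots\wedge\xi_m}_{\alpha_m}\in\Lambda^{|\boldsymbol{k}\alpha|}$$ (the constant $1\in\Lambda^0$ if $\alpha=0$). Let $\langle\,\cdot\,;\,\cdot\,\rangle$ be the scalar product of forms, $\langle c;\xi\rangle=\sum_I c_I\xi_I$ over strictly increasing multi-indices $I$. Let $T(\boldsymbol{\xi})$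 be the vector of all $\boldsymbol{\xi}^{\alpha}$ with $1\le|\boldsymbol{k}\alpha|\le n$. Let $f:\boldsymbol{\Lambda^k}\to\mathbb{R}$ be any function. The following statements are equivalent. (i) $f$ is vectorially ext. polyaffine: there is an affine function $F$ on $\prod_{\alpha:\,1\le|\boldsymbol{k}\alpha|\le n}\Lambda^{|\boldsymbol{k}\alpha|}$ with $f(\boldsymbol{\xi})=F(T(\boldsymbol{\xi}))$ for all $\boldsymbol{\xi}\in\boldsymbol{\Lambda^k}$. (ii) $f$ is vectorially ext. quasiaffine: $f$ is Borel measurable and locally bounded, and for every nonempty bounded open set $\Omega\subset\mathbb{R}^n$, $$\frac1{|\Omega|}\int_\Omega f\big(\xi_1+d\omega_1(x),\dots,\xi_m+d\omega_m(x)\big)\,dx=f(\xi_1,\dots,\xi_m)$$ for all $\xi_i\in\Lambda^{k_i}$ and all $\omega_i\in W^{1,\infty}_0(\Omega;\Lambda^{k_i-1})$, $1\le i\le m$, where $W_0^{1,\infty}(\Omega)=W^{1,\infty}(\Omega)\cap W^{1,1}_0(\Omega)$ and $W_0^{1,1}(\Omega)$ is the closure of $C_c^\infty(\Omega)$ in $W^{1,1}(\Omega)$.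 (iii) $f$ is vectorially ext. one affine: for all $\xi_i\in\Lambda^{k_i}$, $a\in\Lambda^1$ and $\beta_i\in\Lambda^{k_i-1}$ $(1\le i\le m)$, the function $t\mapsto f(\xi_1+t\,a\wedge\beta_1,\dots,\xi_m+t\,a\wedge\beta_m)$ is affine on $\mathbb{R}$. (iv) There exist $c_\alpha\in\Lambda^{|\boldsymbol{k}\alpha|}$, for every $\alpha=(\alpha_1,\dots,\alpha_m)$ with $0\le\alpha_i\le\lfloor n/k_i\rfloor$ for all $i$ and $0\le|\boldsymbol{k}\alpha|\le n$, such that for every $\boldsymbol{\xi}\in\boldsymbol{\Lambda^k}$ $$f(\boldsymbol{\xi})=\sum_{\alpha:\;0\le|\boldsymbol{k}\alpha|\le n}\langle c_\alpha;\boldsymbol{\xi}^{\alpha}\rangle .$$ -/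

import Mathlib

open MeasureTheory Filter Topology

/-! Exterior forms on `ℝⁿ`, and the vectorial notions of affinity for functions of several forms. -/

namespace ExtForms

/-- `Λᵏ(ℝⁿ)`: the space of alternating `k`-linear maps `ℝⁿ × ⋯ × ℝⁿ → ℝ`. -/
abbrev Form (n k : ℕ) : Type :=
  (EuclideanSpace ℝ (Fin n)) [⋀^Fin k]→L[ℝ] ℝ

/-- Transport of a form along an equality of degrees. -/
def Form.cast {n p q : ℕ} (h : p = q) (a : Form n p) : Form n q :=
  { a.toAlternatingMap.domDomCongr (finCongr h) with
    cont := a.cont.comp (continuous_pi fun i => continuous_apply (finCongr h i)) }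

/-- The exterior product as an alternating map: the sum over `(p,q)`-shuffles, without any
normalising factor. -/
noncomputable def wedgeAux {n p q : ℕ} (a : Form n p) (b : Form n q) :
    (EuclideanSpace ℝ (Fin n)) [⋀^Fin (p + q)]→ₗ[ℝ] ℝ :=
  ((LinearMap.mul' ℝ ℝ).compAlternatingMap
    (AlternatingMap.domCoprod a.toAlternatingMap b.toAlternatingMap)).domDomCongr finSumFinEquiv

theorem wedgeAux_continuous {n p q : ℕ} (a : Form n p) (b : Form n q) :
    Continuous (wedgeAux a b) := by
  have h : ⇑(wedgeAux a b) = fun v : Fin (p + q) → EuclideanSpace ℝ (Fin n) =>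
      ∑ σ : Equiv.Perm.ModSumCongr (Fin p) (Fin q), LinearMap.mul' ℝ ℝ
        (AlternatingMap.domCoprod.summand a.toAlternatingMap b.toAlternatingMap σ
          (fun i => v (finSumFinEquiv i))) := by
    funext v
    simp [wedgeAux, AlternatingMap.domCoprod_apply]
    rfl
  rw [h]
  refine continuous_finsetSum _ fun σ _ => ?_
  induction σ using Quotient.inductionOn' with | _ σ
  have ha := a.cont
  have hb := b.cont
  have hc : Continuous fun v : Fin (p + q) → EuclideanSpace ℝ (Fin n) =>
      a (fun i => v (finSumFinEquiv (σ (Sum.inl i)))) *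
        b (fun i => v (finSumFinEquiv (σ (Sum.inr i)))) := by
    refine Continuous.mul ?_ ?_
    · exact ha.comp (continuous_pi fun i => continuous_apply (finSumFinEquiv (σ (Sum.inl i))))
    · exact hb.comp (continuous_pi fun i => continuous_apply (finSumFinEquiv (σ (Sum.inr i))))
  rcases Int.units_eq_one_or (Equiv.Perm.sign σ) with h1 | h1
  · simpa [AlternatingMap.domCoprod.summand_mk'', h1] using hc
  · simpa [AlternatingMap.domCoprod.summand_mk'', h1] using hc.fun_neg

/-- The exterior product `a ∧ b`. -/
noncomputable def wedge {n p q : ℕ} (a : Form n p) (b : Form n q) : Form n (p + q) :=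
  { wedgeAux a b with cont := wedgeAux_continuous a b }

/-- The wedge power `ξ ∧ ⋯ ∧ ξ` (`a` times), of degree `k * a`; it is the constant `1` for
`a = 0`. -/
noncomputable def wedgePow {n k : ℕ} (ξ : Form n k) : (a : ℕ) → Form n (k * a)
  | 0 =>
    Form.cast (Nat.mul_zero k).symm
      (ContinuousAlternatingMap.constOfIsEmpty ℝ (EuclideanSpace ℝ (Fin n)) (Fin 0) (1 : ℝ))
  | a + 1 => wedge (wedgePow ξ a) ξ

/-- The wedge product `ξ₁ ∧ ⋯ ∧ ξₘ` of finitely many forms; the constant `1` for `m = 0`. -/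
noncomputable def wedgeProd {n : ℕ} : {m : ℕ} → {d : Fin m → ℕ} → ((i : Fin m) → Form n (d i)) →
    Form n (∑ i, d i)
  | 0, _, _ =>
    Form.cast (by simp)
      (ContinuousAlternatingMap.constOfIsEmpty ℝ (EuclideanSpace ℝ (Fin n)) (Fin 0) (1 : ℝ))
  | m + 1, d, ξ =>
    Form.cast (Fin.sum_univ_castSucc d).symm
      (wedge (wedgeProd (fun i : Fin m => ξ i.castSucc)) (ξ (Fin.last m)))

/-- `ξ^α = ξ₁^{α₁} ∧ ⋯ ∧ ξₘ^{αₘ}`, a form of degree `|kα| = ∑ kᵢ αᵢ`. -/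
noncomputable def multiWedge {n m : ℕ} {k : Fin m → ℕ} (ξ : (i : Fin m) → Form n (k i))
    (α : Fin m → ℕ) : Form n (∑ i, k i * α i) :=
  wedgeProd (fun i => wedgePow (ξ i) (α i))

/-- The scalar product `⟨c ; ξ⟩ = ∑ c_I ξ_I` of two `s`-forms, the sum running over all strictly
increasing multi-indices `I` of length `s` with entries in `{1, …, n}`. -/
noncomputable def pairing {n s : ℕ} (c ξ : Form n s) : ℝ :=
  ∑ I : Fin s → Fin n with StrictMono I,
    c (fun j => EuclideanSpace.single (I j) (1 : ℝ)) *
      ξ (fun j => EuclideanSpace.single (I j) (1 : ℝ))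

/-- The multi-indices `α` with `0 ≤ αᵢ ≤ [n / kᵢ]` for all `i` and `0 ≤ |kα| ≤ n`. -/
def multiIndices (n : ℕ) {m : ℕ} (k : Fin m → ℕ) : Finset (Fin m → ℕ) :=
  {α ∈ Fintype.piFinset (fun i => Finset.range (n / k i + 1)) | ∑ i, k i * α i ≤ n}

/-- The multi-indices `α` indexing the components of `T(ξ)`: those with `1 ≤ |kα| ≤ n`. -/
abbrev TIndex (n : ℕ) {m : ℕ} (k : Fin m → ℕ) : Type :=
  {α : Fin m → ℕ // α ∈ multiIndices n k ∧ 1 ≤ ∑ i, k i * α i}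

/-- The vector `T(ξ)` of all the wedge products `ξ^α` with `1 ≤ |kα| ≤ n`. -/
noncomputable def wedgeVector {n m : ℕ} {k : Fin m → ℕ} (ξ : (i : Fin m) → Form n (k i))
    (α : TIndex n k) : Form n (∑ i, k i * α.1 i) :=
  multiWedge ξ α.1

/-- `f` is vectorially ext. polyaffine: `f(ξ) = F(T(ξ))` for some affine function `F`. -/
def VectoriallyExtPolyaffine {n m : ℕ} (k : Fin m → ℕ) (f : ((i : Fin m) → Form n (k i)) → ℝ) :
    Prop :=
  ∃ F : ((α : TIndex n k) → Form n (∑ i, k i * α.1 i)) →ᵃ[ℝ] ℝ, ∀ ξ, f ξ = F (wedgeVector ξ)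

/-- `f` is vectorially ext. one affine: for all `ξᵢ ∈ Λ^{kᵢ}`, `a ∈ Λ¹` and `βᵢ ∈ Λ^{kᵢ-1}`, the
function `t ↦ f(ξ₁ + t a ∧ β₁, …, ξₘ + t a ∧ βₘ)` is affine on `ℝ`. -/
def VectoriallyExtOneAffine {n m : ℕ} (k : Fin m → ℕ) (hk : ∀ i, 1 ≤ k i)
    (f : ((i : Fin m) → Form n (k i)) → ℝ) : Prop :=
  ∀ (ξ : (i : Fin m) → Form n (k i)) (a : Form n 1) (β : (i : Fin m) → Form n (k i - 1)),
    ∃ g : ℝ →ᵃ[ℝ] ℝ, ∀ t : ℝ,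
      f (fun i => ξ i + t • Form.cast (Nat.add_sub_of_le (hk i)) (wedge a (β i))) = g t

/-- `G` is the weak (distributional) gradient in `Ω` of the differential form `ω`. -/
def IsWeakGradient {n r : ℕ} (Ω : Set (EuclideanSpace ℝ (Fin n)))
    (ω : EuclideanSpace ℝ (Fin n) → Form n r)
    (G : EuclideanSpace ℝ (Fin n) → EuclideanSpace ℝ (Fin n) →L[ℝ] Form n r) : Prop :=
  ∀ φ : EuclideanSpace ℝ (Fin n) → ℝ, ContDiff ℝ (⊤ : ℕ∞) φ → HasCompactSupport φ →
    tsupport φ ⊆ Ω → ∀ v : EuclideanSpace ℝ (Fin n),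
      ∫ x in Ω, (fderiv ℝ φ x v) • ω x = -∫ x in Ω, φ x • G x v

/-- `ω ∈ W₀^{1,∞}(Ω; Λʳ)`, with weak gradient `G`. As usual in the calculus of variations,
`W₀^{1,∞}(Ω) = W^{1,∞}(Ω) ∩ W₀^{1,1}(Ω)`, where `W₀^{1,1}(Ω)` is the closure of `C_c^∞(Ω)` in
`W^{1,1}(Ω)`. -/
structure IsW01Infty {n r : ℕ} (Ω : Set (EuclideanSpace ℝ (Fin n)))
    (ω : EuclideanSpace ℝ (Fin n) → Form n r)
    (G : EuclideanSpace ℝ (Fin n) → EuclideanSpace ℝ (Fin n) →L[ℝ] Form n r) : Prop where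
  memLp : MemLp ω ⊤ (volume.restrict Ω)
  memLp_gradient : MemLp G ⊤ (volume.restrict Ω)
  isWeakGradient : IsWeakGradient Ω ω G
  exists_approx : ∃ φ : ℕ → EuclideanSpace ℝ (Fin n) → Form n r,
    (∀ j, ContDiff ℝ (⊤ : ℕ∞) (φ j) ∧ HasCompactSupport (φ j) ∧ tsupport (φ j) ⊆ Ω) ∧
    Tendsto (fun j => eLpNorm (φ j - ω) 1 (volume.restrict Ω)) atTop (𝓝 0) ∧
    Tendsto (fun j => eLpNorm (fderiv ℝ (φ j) - G) 1 (volume.restrict Ω)) atTop (𝓝 0)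

/-- The exterior derivative `dω(x) ∈ Λᵏ` of a `(k-1)`-form, in terms of the gradient
`g = ∇ω(x)`: `dω(x)(v₀, …, v_{k-1}) = ∑ᵢ (-1)ⁱ ∂_{vᵢ} ω(x)(v₀, …, v̂ᵢ, …, v_{k-1})`. -/
noncomputable def dOfGradient {n k : ℕ} (hk : 1 ≤ k)
    (g : EuclideanSpace ℝ (Fin n) →L[ℝ] Form n (k - 1)) : Form n k :=
  Form.cast (Nat.sub_add_cancel hk) (ContinuousAlternatingMap.alternatizeUncurryFin g)

/-- `f` is vectorially ext. quasiaffine: `f` is Borel measurable, locally bounded, and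
`(1 / |Ω|) ∫_Ω f(ξ₁ + dω₁(x), …, ξₘ + dωₘ(x)) dx = f(ξ₁, …, ξₘ)` for all nonempty bounded open
`Ω ⊆ ℝⁿ`, all `ξᵢ ∈ Λ^{kᵢ}` and all `ωᵢ ∈ W₀^{1,∞}(Ω; Λ^{kᵢ-1})`. -/
def VectoriallyExtQuasiaffine {n m : ℕ} (k : Fin m → ℕ) (hk : ∀ i, 1 ≤ k i)
    (f : ((i : Fin m) → Form n (k i)) → ℝ) : Prop :=
  Measurable[borel ((i : Fin m) → Form n (k i))] f ∧
  (∀ ξ, ∃ U ∈ 𝓝 ξ, ∃ C : ℝ, ∀ η ∈ U, |f η| ≤ C) ∧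
  ∀ Ω : Set (EuclideanSpace ℝ (Fin n)), IsOpen Ω → Bornology.IsBounded Ω → Ω.Nonempty →
    ∀ (ξ : (i : Fin m) → Form n (k i))
      (ω : (i : Fin m) → EuclideanSpace ℝ (Fin n) → Form n (k i - 1))
      (G : (i : Fin m) → EuclideanSpace ℝ (Fin n) →
        EuclideanSpace ℝ (Fin n) →L[ℝ] Form n (k i - 1)),
      (∀ i, IsW01Infty Ω (ω i) (G i)) →
      ⨍ x in Ω, f (fun i => ξ i + dOfGradient (hk i) (G i x)) = f ξ

end ExtForms

/-! ### Forms inside the exterior algebra of the dual space -/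

namespace ExtForms
open ExteriorAlgebra
open scoped Nat

/-! Everything passes through one affinity and the explicit formula (iv). All computations with
forms take place in the exterior algebra of the dual, into which `toExt` embeds them
multiplicatively. There a product of factors `x + t p ∧ y` has no term in `t²`, because `p` would
occur twice; this gives (iv) ⇒ (iii) (`oneAffine_of_pairing`). Polyaffinity is formula (iv) read
through Riesz representation for the scalar product of forms (`polyaffine_iff_pairing`).

The main step (iii) ⇒ (iv) (`exists_pairing_of_oneAffine`) needs no regularity of `f`. A quotient
`R` of the group algebra of translations carries a multiplicative map `T` and a linear functional
`Φ` with `f(ξ) = Φ(T(ξ))`, and an identity in `R` may be tested on `f`. One affinity becomes `T(tv)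
= 1 + t(T(v) - 1)` for `v = (p ∧ β₁, …, p ∧ βₘ)`. Hence `T(v) - 1` squares to zero, and these
increments are additive as long as the sum is again such a vector. On decomposable forms in slot `i`
they are therefore multilinear and alternating in the covectors and extend to a linear map `Lᵢ`
(`logT`). Forms are sums of decomposables, so `T(ξ) = ∏ exp Lᵢ(ξᵢ)`. Since `Lᵢ(p ∧ x) Lⱼ(p ∧ y) =
0`, products of these maps are again alternating in all the covectors (`exists_mul_extension`), so
`∏ Lᵢ(ξᵢ)^αᵢ` is a linear function of `ξ^α`. It vanishes when the degree exceeds `n`; applying `Φ`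
yields `c_α`.

For (iii) ⇒ (ii), `f` is now known to be smooth, and its second derivative vanishes twice along each
direction `p ∧ β`, the values of `d` on rank-one gradients. This makes `f'(ξ + t dφ)(dφ)` a
divergence for test functions `φ` (`integral_fderiv_eq_zero`). Mollifying the extension by zero and
dominated convergence carry the identity to `W₀^{1,∞}`.

For (ii) ⇒ (iii), the test fields are tent functions over the parallelepiped of a basis `p₁, …, pₙ`
of covectors, times constant forms. Their gradients take the values `±pᵢ` on sets of equal measure,
so the second differences of `f` sum to zero over every basis, which forces each of them to vanish.
Thus `f` is midpoint affine along the lines in question, and Borel measurability upgrades this to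
affine. -/

/-- The exterior algebra of the dual of `ℝⁿ`. -/
abbrev DualExt (n : ℕ) : Type := ExteriorAlgebra ℝ (EuclideanSpace ℝ (Fin n) →L[ℝ] ℝ)

/-- The wedge `e^{I₁} ∧ ⋯ ∧ e^{I_k}` of coordinate covectors. -/
noncomputable def coordWedge {n k : ℕ} (I : Fin k → Fin n) : DualExt n :=
  ιMulti ℝ k fun j => (EuclideanSpace.proj (I j) : EuclideanSpace ℝ (Fin n) →L[ℝ] ℝ)

/-- The value `a_I` of a form on the coordinate vectors `e_{I₁}, …, e_{I_k}`. -/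
noncomputable def coeff {n k : ℕ} (a : Form n k) (I : Fin k → Fin n) : ℝ :=
  a fun j => EuclideanSpace.single (I j) (1 : ℝ)

/-- The embedding of the `k`-forms into the exterior algebra of the dual. -/
noncomputable def toExt (n k : ℕ) : Form n k →ₗ[ℝ] DualExt n where
  toFun a := (k ! : ℝ)⁻¹ • ∑ I : Fin k → Fin n, coeff a I • coordWedge I
  map_add' a b := by
    simp [coeff, add_smul, Finset.sum_add_distrib]
  map_smul' c a := by
    simp only [coeff, ContinuousAlternatingMap.smul_apply, smul_eq_mul, mul_smul, RingHom.id_apply,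
      ← Finset.smul_sum]
    rw [smul_comm]

theorem toExt_apply {n k : ℕ} (a : Form n k) :
    toExt n k a = (k ! : ℝ)⁻¹ • ∑ I : Fin k → Fin n, coeff a I • coordWedge I := rfl

theorem cast_rfl {n p : ℕ} (a : Form n p) : Form.cast rfl a = a := by
  ext v; rfl

theorem toExt_cast {n p q : ℕ} (h : p = q) (a : Form n p) :
    toExt n q (Form.cast h a) = toExt n p a := by
  subst h; rw [cast_rfl]

theorem toExt_constOfIsEmpty (n : ℕ) :
    toExt n 0 (ContinuousAlternatingMap.constOfIsEmpty ℝ (EuclideanSpace ℝ (Fin n)) (Fin 0)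
      (1 : ℝ)) = 1 := by
  simp [toExt_apply, coeff, coordWedge]

/-- Each shuffle class contains `p! q!` permutations. Summing over the whole permutation group
avoids its quotient in later computations. -/
theorem wedge_apply {n p q : ℕ} (a : Form n p) (b : Form n q)
    (v : Fin (p + q) → EuclideanSpace ℝ (Fin n)) :
    (p ! * q ! : ℝ) * wedge a b v = ∑ σ : Equiv.Perm (Fin p ⊕ Fin q),
      ((Equiv.Perm.sign σ : ℤ) : ℝ) * (a (fun i => v (finSumFinEquiv (σ (.inl i)))) *
        b (fun i => v (finSumFinEquiv (σ (.inr i))))) := by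
  have h := MultilinearMap.domCoprod_alternization_eq (R' := ℝ) a.toAlternatingMap
    b.toAlternatingMap
  have h2 := congrArg (fun m => LinearMap.mul' ℝ ℝ (m (fun i => v (finSumFinEquiv i)))) h
  simp only [MultilinearMap.alternatization_apply, map_sum] at h2
  have h3 : wedge a b v = LinearMap.mul' ℝ ℝ
      ((a.toAlternatingMap.domCoprod b.toAlternatingMap) (fun i => v (finSumFinEquiv i))) := rfl
  rw [h3]
  simp only [Fintype.card_fin, AlternatingMap.smul_apply, map_nsmul] at h2
  rw [nsmul_eq_mul] at h2
  push_cast at h2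
  rw [← h2]
  refine Finset.sum_congr rfl fun σ _ => ?_
  rcases Int.units_eq_one_or (Equiv.Perm.sign σ) with h1 | h1 <;> simp [h1]

theorem coordWedge_comp_perm {n k : ℕ} (I : Fin k → Fin n) (σ : Equiv.Perm (Fin k)) :
    coordWedge (I ∘ σ) = ((Equiv.Perm.sign σ : ℤ) : ℝ) • coordWedge I := by
  have := (ιMulti ℝ k).map_perm (fun j =>
    (EuclideanSpace.proj (I j) : EuclideanSpace ℝ (Fin n) →L[ℝ] ℝ)) σ
  rw [coordWedge, coordWedge]
  refine this.trans ?_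
  rcases Int.units_eq_one_or (Equiv.Perm.sign σ) with h1 | h1 <;> simp [h1]

theorem coordWedge_mul {n p q : ℕ} (I : Fin p → Fin n) (J : Fin q → Fin n) :
    coordWedge I * coordWedge J = coordWedge (Fin.append I J) := by
  rw [coordWedge, coordWedge, coordWedge, ιMulti_mul_ιMulti]
  congr 1
  funext j
  refine Fin.addCases (fun i => ?_) (fun i => ?_) j <;> simp

/-- All `(p + q)!` permutations contribute the same product: reindexing `I` by the permutation
produces its sign from `coordWedge`, which cancels the sign in `wedge_apply`. The factorials in
`toExt` are chosen to absorb this count. -/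
theorem toExt_wedge {n p q : ℕ} (a : Form n p) (b : Form n q) :
    toExt n (p + q) (wedge a b) = toExt n p a * toExt n q b := by
  have hp : (p ! : ℝ) ≠ 0 := by positivity
  have hq : (q ! : ℝ) ≠ 0 := by positivity
  have hpq : ((p + q) ! : ℝ) ≠ 0 := by positivity
  have key : (p ! * q ! : ℝ) • ∑ I : Fin (p + q) → Fin n, coeff (wedge a b) I • coordWedge I =
      ((p + q) ! : ℝ) • ((∑ I : Fin p → Fin n, coeff a I • coordWedge I) *
        ∑ J : Fin q → Fin n, coeff b J • coordWedge J) := by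
    have h1 : ∀ σ : Equiv.Perm (Fin p ⊕ Fin q), ∑ I : Fin (p + q) → Fin n,
        (((Equiv.Perm.sign σ : ℤ) : ℝ) * (coeff a (fun i => I (finSumFinEquiv (σ (.inl i)))) *
        coeff b (fun i => I (finSumFinEquiv (σ (.inr i)))))) • coordWedge I =
        (∑ I : Fin p → Fin n, coeff a I • coordWedge I) *
        ∑ J : Fin q → Fin n, coeff b J • coordWedge J := by
      intro σ
      rw [Finset.sum_mul_sum, ← Finset.sum_product', Finset.univ_product_univ]
      let τ : Equiv.Perm (Fin (p + q)) := finSumFinEquiv.permCongr σ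
      have hs : Equiv.Perm.sign τ = Equiv.Perm.sign σ := Equiv.Perm.sign_permCongr _ _
      let e : (Fin (p + q) → Fin n) ≃ (Fin p → Fin n) × (Fin q → Fin n) :=
        (Equiv.arrowCongr τ.symm (Equiv.refl _)).trans (Fin.appendEquiv p q).symm
      refine Fintype.sum_equiv e _ _ fun I => ?_
      have e1 : (e I).1 = fun i => I (finSumFinEquiv (σ (.inl i))) := by
        funext i
        simp [e, Fin.appendEquiv, τ, Equiv.permCongr_apply]
      have e2 : (e I).2 = fun i => I (finSumFinEquiv (σ (.inr i))) := by
        funext i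
        simp [e, Fin.appendEquiv, τ, Equiv.permCongr_apply]
      have e3 : Fin.append (e I).1 (e I).2 = I ∘ τ := by
        funext j
        refine Fin.addCases (fun i => ?_) (fun i => ?_) j
        · simp [e1, τ, Equiv.permCongr_apply]
        · simp [e2, τ, Equiv.permCongr_apply]
      rw [smul_mul_smul_comm, coordWedge_mul, e3, coordWedge_comp_perm, hs, e1, e2, smul_smul]
      congr 1
      ring
    rw [Finset.smul_sum]
    have h2 : ∀ I : Fin (p + q) → Fin n, (p ! * q ! : ℝ) • coeff (wedge a b) I • coordWedge I =
        ∑ σ : Equiv.Perm (Fin p ⊕ Fin q), (((Equiv.Perm.sign σ : ℤ) : ℝ) *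
          (coeff a (fun i => I (finSumFinEquiv (σ (.inl i)))) *
          coeff b (fun i => I (finSumFinEquiv (σ (.inr i)))))) • coordWedge I := by
      intro I
      rw [smul_smul, coeff, wedge_apply, Finset.sum_smul]
      rfl
    simp only [h2]
    rw [Finset.sum_comm]
    simp only [h1]
    rw [Finset.sum_const, Finset.card_univ, Fintype.card_perm, Fintype.card_sum, Fintype.card_fin,
      Fintype.card_fin, ← Nat.cast_smul_eq_nsmul ℝ]
  rw [toExt_apply, toExt_apply, toExt_apply, smul_mul_smul_comm, inv_smul_eq_iff₀ hpq,
    ← mul_inv, smul_comm, ← key, smul_smul, inv_mul_cancel₀ (by positivity), one_smul]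

/-- The determinant `det (uᵢ(vⱼ))` as an alternating function of the covectors `uᵢ`. -/
noncomputable def detPairing {n k : ℕ} (v : Fin k → EuclideanSpace ℝ (Fin n)) :
    (EuclideanSpace ℝ (Fin n) →L[ℝ] ℝ) [⋀^Fin k]→ₗ[ℝ] ℝ :=
  Matrix.detRowAlternating.compLinearMap
    (LinearMap.pi fun j => (ContinuousLinearMap.apply ℝ ℝ (v j)).toLinearMap)

theorem detPairing_apply {n k : ℕ} (v : Fin k → EuclideanSpace ℝ (Fin n))
    (u : Fin k → EuclideanSpace ℝ (Fin n) →L[ℝ] ℝ) :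
    detPairing v u = ∑ σ : Equiv.Perm (Fin k), ((Equiv.Perm.sign σ : ℤ) : ℝ) *
      ∏ i, u i (v (σ i)) := by
  have : detPairing v u = (Matrix.of fun i j => u i (v j)).det := rfl
  rw [this, ← Matrix.det_transpose, Matrix.det_apply']
  rfl

theorem form_apply_eq_sum {n k : ℕ} (a : Form n k) (v : Fin k → EuclideanSpace ℝ (Fin n)) :
    a v = ∑ I : Fin k → Fin n, (∏ i, v i (I i)) * coeff a I := by
  have hv : v = fun i => ∑ j, v i j • EuclideanSpace.single j (1 : ℝ) := by
    funext i
    ext l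
    simp [Pi.single_apply]
  conv_lhs => rw [hv]
  have := a.toMultilinearMap.map_sum (fun i j => v i j • EuclideanSpace.single j (1 : ℝ))
  refine this.trans (Finset.sum_congr rfl fun I _ => ?_)
  exact a.toMultilinearMap.map_smul_univ _ _

/-- Pairing with determinants recovers a form from its image: each of the `k!` permutations
contributes `a v`. Injectivity follows, so identities between forms may be checked in the exterior
algebra. -/
theorem liftAlternating_toExt {n k : ℕ} (a : Form n k) (v : Fin k → EuclideanSpace ℝ (Fin n)) :
    liftAlternating (Function.update (0 : ∀ i,
      (EuclideanSpace ℝ (Fin n) →L[ℝ] ℝ) [⋀^Fin i]→ₗ[ℝ] ℝ) k (detPairing v)) (toExt n k a) =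
      a v := by
  rw [toExt_apply, map_smul, map_sum]
  simp only [map_smul, coordWedge, liftAlternating_apply_ιMulti, Function.update_self,
    detPairing_apply, smul_eq_mul, Finset.mul_sum]
  rw [Finset.sum_comm]
  have h : ∀ σ : Equiv.Perm (Fin k), ∑ I : Fin k → Fin n, coeff a I *
      (((Equiv.Perm.sign σ : ℤ) : ℝ) * ∏ i, (EuclideanSpace.proj (I i) :
        EuclideanSpace ℝ (Fin n) →L[ℝ] ℝ) (v (σ i))) = a v := by
    intro σ
    have h1 := a.toAlternatingMap.map_perm v σ
    have h2 := form_apply_eq_sum a (v ∘ σ)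
    have h3 : a (v ∘ σ) = ((Equiv.Perm.sign σ : ℤ) : ℝ) * a v := by
      refine h1.trans ?_
      rcases Int.units_eq_one_or (Equiv.Perm.sign σ) with h1 | h1 <;> simp [h1]
    have h4 : a v = ((Equiv.Perm.sign σ : ℤ) : ℝ) * a (v ∘ σ) := by
      rw [h3]
      rcases Int.units_eq_one_or (Equiv.Perm.sign σ) with h1 | h1 <;> simp [h1]
    rw [h4, h2, Finset.mul_sum]
    refine Finset.sum_congr rfl fun I _ => ?_
    simp only [Function.comp_apply]
    rw [mul_comm (coeff a I), mul_assoc]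
    rfl
  simp only [← Finset.mul_sum, h]
  rw [Finset.sum_const, Finset.card_univ, Fintype.card_perm, Fintype.card_fin, nsmul_eq_mul,
    inv_mul_cancel_left₀ (by positivity)]

theorem toExt_injective (n k : ℕ) : Function.Injective (toExt n k) := fun a b h => by
  ext v
  rw [← liftAlternating_toExt a v, h, liftAlternating_toExt]

/-- The `1`-form given by a covector. -/
noncomputable def covectorForm {n : ℕ} (p : EuclideanSpace ℝ (Fin n) →L[ℝ] ℝ) : Form n 1 :=
  ContinuousAlternatingMap.ofSubsingleton ℝ (EuclideanSpace ℝ (Fin n)) ℝ (0 : Fin 1) p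

theorem covector_eq_sum {n : ℕ} (p : EuclideanSpace ℝ (Fin n) →L[ℝ] ℝ) :
    p = ∑ j, p (EuclideanSpace.single j 1) •
      (EuclideanSpace.proj j : EuclideanSpace ℝ (Fin n) →L[ℝ] ℝ) := by
  ext v
  have hv : v = ∑ j, v j • EuclideanSpace.single j (1 : ℝ) := by
    ext l
    simp [Pi.single_apply]
  conv_lhs => rw [hv]
  simp [mul_comm]

theorem toExt_covectorForm {n : ℕ} (p : EuclideanSpace ℝ (Fin n) →L[ℝ] ℝ) :
    toExt n 1 (covectorForm p) = ι ℝ p := by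
  conv_rhs => rw [covector_eq_sum p]
  rw [toExt_apply]
  simp only [Nat.factorial_one, Nat.cast_one, inv_one, one_smul, map_sum, map_smul]
  refine Fintype.sum_equiv (Equiv.funUnique (Fin 1) (Fin n)) _ _ fun I => ?_
  simp [coeff, covectorForm, coordWedge]

theorem exists_covectorForm_eq {n : ℕ} (a : Form n 1) : ∃ p, covectorForm p = a :=
  (ContinuousAlternatingMap.ofSubsingleton ℝ (EuclideanSpace ℝ (Fin n)) ℝ (0 : Fin 1)).surjective a

theorem coordWedge_vecCons {n k : ℕ} (j : Fin n) (I : Fin k → Fin n) :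
    ι ℝ (EuclideanSpace.proj j : EuclideanSpace ℝ (Fin n) →L[ℝ] ℝ) * coordWedge I =
      coordWedge (Matrix.vecCons j I) := by
  rw [coordWedge, coordWedge, ιMulti_succ_apply]
  rfl

/-- The `q + 1` positions of the differentiated slot contribute equally, since `(-1)^i` is also the
sign of moving the `i`-th covector to the front. The factor `q + 1` turns `1/(q+1)!` into `1/q!`. -/
theorem toExt_alternatizeUncurryFin {n q : ℕ} (p : EuclideanSpace ℝ (Fin n) →L[ℝ] ℝ)
    (b : Form n q) :
    toExt n (q + 1) (ContinuousAlternatingMap.alternatizeUncurryFin (p.smulRight b)) =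
      ι ℝ p * toExt n q b := by
  conv_rhs => rw [covector_eq_sum p]
  have key : ∀ i : Fin (q + 1), ∑ I : Fin (q + 1) → Fin n, ((-1 : ℝ) ^ (i : ℕ) *
      (p (EuclideanSpace.single (I i) 1) * coeff b (i.removeNth I))) • coordWedge I =
      (∑ j, p (EuclideanSpace.single j 1) •
        ι ℝ (EuclideanSpace.proj j : EuclideanSpace ℝ (Fin n) →L[ℝ] ℝ)) *
        ∑ J : Fin q → Fin n, coeff b J • coordWedge J := by
    intro i
    rw [Finset.sum_mul_sum, ← Finset.sum_product', Finset.univ_product_univ]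
    refine Fintype.sum_equiv (Fin.insertNthEquiv (fun _ => Fin n) i).symm _ _ fun I => ?_
    rw [smul_mul_smul_comm, coordWedge_vecCons]
    have h1 : coordWedge I = (-1 : ℝ) ^ (i : ℕ) •
        coordWedge (Matrix.vecCons (I i) (i.removeNth I)) := by
      have h2 := (ιMulti ℝ (q + 1)).map_insertNth i
        (EuclideanSpace.proj (I i) : EuclideanSpace ℝ (Fin n) →L[ℝ] ℝ)
        (fun j => EuclideanSpace.proj (i.removeNth I j))
      have h3 : (i.insertNth (EuclideanSpace.proj (I i) : EuclideanSpace ℝ (Fin n) →L[ℝ] ℝ)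
          (fun j => EuclideanSpace.proj (i.removeNth I j)) : Fin (q + 1) → _) =
          fun j => EuclideanSpace.proj (I j) := by
        funext j
        refine Fin.succAboveCases i ?_ (fun l => ?_) j <;> simp [Fin.removeNth]
      have h4 : (Matrix.vecCons (EuclideanSpace.proj (I i) : EuclideanSpace ℝ (Fin n) →L[ℝ] ℝ)
          (fun j => EuclideanSpace.proj (i.removeNth I j)) : Fin (q + 1) → _) =
          fun j => EuclideanSpace.proj ((Matrix.vecCons (I i) (i.removeNth I) : _ → Fin n) j) := by
        funext j
        refine Fin.cases ?_ (fun l => ?_) j <;> simp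
      rw [h3, h4] at h2
      rw [coordWedge, h2, coordWedge]
      rcases Nat.even_or_odd (i : ℕ) with h | h <;> simp [h.neg_one_pow]
    conv_lhs => rw [h1]
    rw [smul_smul]
    congr 1
    have : ((-1 : ℝ) ^ (i : ℕ)) * (-1) ^ (i : ℕ) = 1 := by
      rw [← mul_pow]; simp
    simp only [Fin.insertNthEquiv_symm_apply]
    linear_combination p (EuclideanSpace.single (I i) 1) * coeff b (i.removeNth I) * this
  rw [toExt_apply, toExt_apply, mul_smul_comm, map_sum]
  simp only [map_smul]
  have h1 : ∀ I : Fin (q + 1) → Fin n,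
      coeff (ContinuousAlternatingMap.alternatizeUncurryFin (p.smulRight b)) I • coordWedge I =
      ∑ i : Fin (q + 1), ((-1 : ℝ) ^ (i : ℕ) *
      (p (EuclideanSpace.single (I i) 1) * coeff b (i.removeNth I))) • coordWedge I := by
    intro I
    rw [coeff, ContinuousAlternatingMap.alternatizeUncurryFin_apply, ← Finset.sum_smul]
    congr 1
    refine Finset.sum_congr rfl fun i _ => ?_
    rcases Nat.even_or_odd (i : ℕ) with h | h <;> simp [h.neg_one_pow] <;> exact Or.inl rfl
  simp only [h1]
  rw [Finset.sum_comm]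
  simp only [key]
  rw [Finset.sum_const, Finset.card_univ, Fintype.card_fin, ← Nat.cast_smul_eq_nsmul ℝ, smul_smul,
    Nat.factorial_succ]
  congr 1
  push_cast
  field_simp

/-- The symbol of `d` is the wedge with a covector. This ties the gradients of test fields to the
directions in one affinity. -/
theorem dOfGradient_smulRight {n k : ℕ} (hk : 1 ≤ k) (p : EuclideanSpace ℝ (Fin n) →L[ℝ] ℝ)
    (b : Form n (k - 1)) :
    dOfGradient hk (p.smulRight b) =
      Form.cast (Nat.add_sub_of_le hk) (wedge (covectorForm p) b) := by
  apply toExt_injective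
  rw [dOfGradient, toExt_cast, toExt_cast, toExt_wedge, toExt_alternatizeUncurryFin,
    toExt_covectorForm]

theorem ιMulti_mem_range_toExt {n : ℕ} : ∀ {k : ℕ}
    (u : Fin k → EuclideanSpace ℝ (Fin n) →L[ℝ] ℝ), ∃ a, toExt n k a = ιMulti ℝ k u
  | 0, u => ⟨_, (toExt_constOfIsEmpty n).trans (ιMulti_zero_apply u).symm⟩
  | k + 1, u => by
    obtain ⟨a, ha⟩ := ιMulti_mem_range_toExt (Matrix.vecTail u)
    refine ⟨Form.cast (Nat.add_comm 1 k) (wedge (covectorForm (u 0)) a), ?_⟩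
    rw [toExt_cast, toExt_wedge, ha, toExt_covectorForm, ιMulti_succ_apply]

theorem toExt_mem_exteriorPower {n k : ℕ} (a : Form n k) :
    toExt n k a ∈ ⋀[ℝ]^k (EuclideanSpace ℝ (Fin n) →L[ℝ] ℝ) := by
  rw [toExt_apply]
  refine Submodule.smul_mem _ _ (Submodule.sum_mem _ fun I _ => Submodule.smul_mem _ _ ?_)
  exact ιMulti_range ℝ k ⟨_, rfl⟩

/-- A linear left inverse of `toExt`. -/
noncomputable def ofExt (n k : ℕ) : DualExt n →ₗ[ℝ] Form n k :=
  ((toExt n k).exists_leftInverse_of_injective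
    (LinearMap.ker_eq_bot.mpr (toExt_injective n k))).choose

theorem ofExt_toExt {n k : ℕ} (a : Form n k) : ofExt n k (toExt n k a) = a :=
  LinearMap.congr_fun ((toExt n k).exists_leftInverse_of_injective
    (LinearMap.ker_eq_bot.mpr (toExt_injective n k))).choose_spec a

/-- The decomposable form `u₁ ∧ ⋯ ∧ u_k`, as an alternating function of the covectors `uᵢ`. -/
noncomputable def decomposable (n k : ℕ) :
    (EuclideanSpace ℝ (Fin n) →L[ℝ] ℝ) [⋀^Fin k]→ₗ[ℝ] Form n k :=
  (ofExt n k).compAlternatingMap (ιMulti ℝ k)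

theorem toExt_decomposable {n k : ℕ} (u : Fin k → EuclideanSpace ℝ (Fin n) →L[ℝ] ℝ) :
    toExt n k (decomposable n k u) = ιMulti ℝ k u := by
  obtain ⟨a, ha⟩ := ιMulti_mem_range_toExt u
  rw [decomposable, LinearMap.compAlternatingMap_apply, ← ha, ofExt_toExt]

/-- Allows identities compatible with sums to be checked on decomposable forms only. -/
theorem span_decomposable (n k : ℕ) :
    Submodule.span ℝ (Set.range (decomposable n k)) = ⊤ := by
  refine eq_top_iff.mpr fun a _ => ?_
  have h := toExt_mem_exteriorPower a
  rw [← ιMulti_span_fixedDegree] at h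
  have h2 := Submodule.mem_map_of_mem (f := ofExt n k) h
  rw [ofExt_toExt, Submodule.map_span, ← Set.range_comp] at h2
  exact h2

theorem decomposable_succ {n k : ℕ} (hk : 1 ≤ k) (u : Fin k → EuclideanSpace ℝ (Fin n) →L[ℝ] ℝ) :
    decomposable n k u = Form.cast (Nat.add_sub_of_le hk)
      (wedge (covectorForm (u ⟨0, hk⟩))
        (decomposable n (k - 1) fun j => u ⟨j + 1, by omega⟩)) := by
  apply toExt_injective
  rw [toExt_cast, toExt_wedge, toExt_covectorForm, toExt_decomposable, toExt_decomposable]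
  obtain ⟨k, rfl⟩ := Nat.exists_eq_add_of_le' hk
  rw [ιMulti_succ_apply]
  rfl

/-- More than `n` covectors on `ℝⁿ` are linearly dependent, so their wedge vanishes. -/
theorem exteriorPower_eq_bot {n k : ℕ} (h : n < k) {x : DualExt n}
    (hx : x ∈ ⋀[ℝ]^k (EuclideanSpace ℝ (Fin n) →L[ℝ] ℝ)) : x = 0 := by
  rw [← ιMulti_span_fixedDegree] at hx
  have : Set.range (ιMulti ℝ k (M := EuclideanSpace ℝ (Fin n) →L[ℝ] ℝ)) ⊆ {0} := by
    rintro _ ⟨u, rfl⟩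
    refine (ιMulti ℝ k).map_linearDependent u fun hl => ?_
    have h1 := hl.fintype_card_le_finrank
    have h2 : Module.finrank ℝ (EuclideanSpace ℝ (Fin n) →L[ℝ] ℝ) = n := by
      rw [← (LinearMap.toContinuousLinearMap (𝕜 := ℝ) (E := EuclideanSpace ℝ (Fin n))
        (F' := ℝ)).finrank_eq]
      simp
    rw [h2, Fintype.card_fin] at h1
    omega
  simpa using Submodule.span_mono this hx

end ExtForms

/-! ### Powers and scalar product; (iv) ⇒ (iii) and (i) ⇔ (iv) -/

namespace ExtForms
open ExteriorAlgebra
open scoped Nat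

theorem toExt_wedgePow {n k : ℕ} (ξ : Form n k) (a : ℕ) :
    toExt n (k * a) (wedgePow ξ a) = toExt n k ξ ^ a := by
  induction a with
  | zero => rw [wedgePow, toExt_cast, toExt_constOfIsEmpty, pow_zero]
  | succ a ih => rw [pow_succ, ← ih]; exact toExt_wedge (wedgePow ξ a) ξ

theorem toExt_wedgeProd {n : ℕ} : ∀ {m : ℕ} {d : Fin m → ℕ} (ξ : (i : Fin m) → Form n (d i)),
    toExt n (∑ i, d i) (wedgeProd ξ) = (List.ofFn fun i => toExt n (d i) (ξ i)).prod
  | 0, _, _ => by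
    rw [wedgeProd, toExt_cast, toExt_constOfIsEmpty, List.ofFn_zero, List.prod_nil]
  | m + 1, d, ξ => by
    rw [wedgeProd, toExt_cast, toExt_wedge, toExt_wedgeProd, List.ofFn_succ', List.prod_concat]

theorem toExt_multiWedge {n m : ℕ} {k : Fin m → ℕ} (ξ : (i : Fin m) → Form n (k i))
    (α : Fin m → ℕ) : toExt n (∑ i, k i * α i) (multiWedge ξ α) =
      (List.ofFn fun i => toExt n (k i) (ξ i) ^ α i).prod := by
  rw [multiWedge, toExt_wedgeProd]
  simp only [toExt_wedgePow]

theorem pairing_eq {n s : ℕ} (c ξ : Form n s) :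
    pairing c ξ = ∑ I : Fin s → Fin n with StrictMono I, coeff c I * coeff ξ I := rfl

/-- The scalar product of forms as a bilinear map. -/
noncomputable def pairingBilin (n s : ℕ) : Form n s →ₗ[ℝ] Form n s →ₗ[ℝ] ℝ :=
  LinearMap.mk₂ ℝ pairing
    (fun a b c => by simp [pairing, add_mul, Finset.sum_add_distrib])
    (fun r a b => by simp [pairing, mul_assoc, Finset.mul_sum])
    (fun a b c => by simp [pairing, mul_add, Finset.sum_add_distrib])
    (fun r a b => by simp [pairing, mul_left_comm, Finset.mul_sum])

/-- Sorting an injective multi-index changes the coefficient only by a sign, and a repeated index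
makes it zero. -/
theorem form_eq_zero_of_coeff {n s : ℕ} (c : Form n s)
    (h : ∀ I : Fin s → Fin n, StrictMono I → coeff c I = 0) : c = 0 := by
  have h1 : ∀ I : Fin s → Fin n, coeff c I = 0 := by
    intro I
    by_cases hI : Function.Injective I
    · have hs : StrictMono (I ∘ Tuple.sort I) :=
        (Tuple.monotone_sort I).strictMono_of_injective (hI.comp (Tuple.sort I).injective)
      have h2 := c.toAlternatingMap.map_perm
        (fun j => EuclideanSpace.single (I j) (1 : ℝ)) (Tuple.sort I)
      have h3 : coeff c (I ∘ Tuple.sort I) = Equiv.Perm.sign (Tuple.sort I) • coeff c I := h2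
      rw [h _ hs] at h3
      exact (smul_eq_zero_iff_eq _).mp h3.symm
    · refine c.toAlternatingMap.map_eq_zero_of_not_injective _ fun hi => hI fun i j hij => ?_
      exact hi (by simp only [hij])
  ext v
  rw [form_apply_eq_sum]
  simp [h1]

instance finiteDimensional_form (n k : ℕ) : FiniteDimensional ℝ (Form n k) := by
  let L : Form n k →ₗ[ℝ] ((Fin k → Fin n) → ℝ) :=
    { toFun := fun a I => coeff a I
      map_add' := fun _ _ => rfl
      map_smul' := fun _ _ => rfl }
  refine FiniteDimensional.of_injective L (LinearMap.ker_eq_bot.mp ?_)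
  exact LinearMap.ker_eq_bot'.mpr fun c hc => form_eq_zero_of_coeff c fun I _ => congrFun hc I

theorem eq_zero_of_pairing_self {n s : ℕ} {c : Form n s} (h : pairing c c = 0) : c = 0 := by
  rw [pairing_eq, Finset.sum_eq_zero_iff_of_nonneg fun I _ => mul_self_nonneg _] at h
  exact form_eq_zero_of_coeff c fun I hI =>
    mul_self_eq_zero.mp (h I (Finset.mem_filter.mpr ⟨Finset.mem_univ _, hI⟩))

/-- Definiteness makes `c ↦ ⟨c ; ·⟩` injective into the dual, which has the same finite dimension.
-/
theorem exists_pairing_eq {n s : ℕ} (L : Form n s →ₗ[ℝ] ℝ) : ∃ c, ∀ ξ, L ξ = pairing c ξ := by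
  have hinj : Function.Injective (pairingBilin n s) := by
    refine LinearMap.ker_eq_bot.mp (LinearMap.ker_eq_bot'.mpr fun c hc => ?_)
    exact eq_zero_of_pairing_self (LinearMap.congr_fun hc c)
  have hsurj := (LinearMap.injective_iff_surjective_of_finrank_eq_finrank
    (Subspace.dual_finrank_eq (K := ℝ) (V := Form n s)).symm).mp hinj
  obtain ⟨c, hc⟩ := hsurj L
  exact ⟨c, fun ξ => by rw [← hc]; rfl⟩

/-- Covectors anticommute, so `p` can be moved to the left through anything. Hence a product
containing `p` twice vanishes even if the two occurrences are apart. -/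
theorem exists_mul_ι_eq {n : ℕ} (p : EuclideanSpace ℝ (Fin n) →L[ℝ] ℝ) (x : DualExt n) :
    ∃ y, x * ι ℝ p = ι ℝ p * y := by
  induction x using ExteriorAlgebra.induction with
  | algebraMap r => exact ⟨algebraMap ℝ _ r, Algebra.commutes r _⟩
  | ι q => exact ⟨-ι ℝ q, by rw [mul_neg, eq_neg_iff_add_eq_zero, ι_add_mul_swap]⟩
  | mul a b ha hb =>
    obtain ⟨y, hy⟩ := ha
    obtain ⟨z, hz⟩ := hb
    exact ⟨y * z, by rw [mul_assoc, hz, ← mul_assoc, hy, mul_assoc]⟩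
  | add a b ha hb =>
    obtain ⟨y, hy⟩ := ha
    obtain ⟨z, hz⟩ := hb
    exact ⟨y + z, by rw [add_mul, hy, hz, mul_add]⟩

/-- The family `g t` in the exterior algebra is of the form `x + t (p ∧ y)`. -/
def IsWedgeLine {n : ℕ} (p : EuclideanSpace ℝ (Fin n) →L[ℝ] ℝ) (g : ℝ → DualExt n) : Prop :=
  ∃ x y, ∀ t, g t = x + t • (ι ℝ p * y)

theorem IsWedgeLine.one {n : ℕ} (p : EuclideanSpace ℝ (Fin n) →L[ℝ] ℝ) :
    IsWedgeLine p fun _ => 1 := ⟨1, 0, fun t => by simp⟩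

/-- The coefficient of `t²` is `p ∧ y ∧ p ∧ w = 0`. -/
theorem IsWedgeLine.mul {n : ℕ} {p : EuclideanSpace ℝ (Fin n) →L[ℝ] ℝ} {g h : ℝ → DualExt n}
    (hg : IsWedgeLine p g) (hh : IsWedgeLine p h) : IsWedgeLine p fun t => g t * h t := by
  obtain ⟨x, y, hg⟩ := hg
  obtain ⟨z, w, hh⟩ := hh
  obtain ⟨x', hx'⟩ := exists_mul_ι_eq p x
  obtain ⟨y', hy'⟩ := exists_mul_ι_eq p y
  refine ⟨x * z, y * z + x' * w, fun t => ?_⟩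
  have h1 : ι ℝ p * y * (ι ℝ p * w) = 0 := by
    rw [mul_assoc, ← mul_assoc y, hy', ← mul_assoc, ← mul_assoc, ι_sq_zero, zero_mul, zero_mul]
  have h2 : x * (ι ℝ p * w) = ι ℝ p * (x' * w) := by rw [← mul_assoc, hx', mul_assoc]
  change g t * h t = _
  rw [hg, hh, add_mul, mul_add, mul_add, mul_smul_comm, h2, smul_mul_smul_comm, h1, smul_zero,
    add_zero, smul_mul_assoc, mul_add, smul_add, add_assoc, mul_assoc, add_comm (t • _) (t • _)]

theorem IsWedgeLine.pow {n : ℕ} {p : EuclideanSpace ℝ (Fin n) →L[ℝ] ℝ} {g : ℝ → DualExt n}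
    (hg : IsWedgeLine p g) (a : ℕ) : IsWedgeLine p fun t => g t ^ a := by
  induction a with
  | zero => simpa using IsWedgeLine.one p
  | succ a ih => simpa only [pow_succ] using ih.mul hg

theorem IsWedgeLine.list_prod {n : ℕ} {p : EuclideanSpace ℝ (Fin n) →L[ℝ] ℝ} :
    ∀ {m : ℕ} {g : Fin m → ℝ → DualExt n}, (∀ i, IsWedgeLine p (g i)) →
      IsWedgeLine p fun t => (List.ofFn fun i => g i t).prod
  | 0, _, _ => by simpa using IsWedgeLine.one p
  | m + 1, g, hg => by
    simp only [List.ofFn_succ, List.prod_cons]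
    exact (hg 0).mul (IsWedgeLine.list_prod fun i => hg i.succ)

theorem oneAffine_of_pairing {n m : ℕ} {k : Fin m → ℕ} (hk : ∀ i, 1 ≤ k i)
    {f : ((i : Fin m) → Form n (k i)) → ℝ} {c : (α : Fin m → ℕ) → Form n (∑ i, k i * α i)}
    (hf : ∀ ξ, f ξ = ∑ α ∈ multiIndices n k, pairing (c α) (multiWedge ξ α)) :
    VectoriallyExtOneAffine k hk f := by
  intro ξ a β
  obtain ⟨p, rfl⟩ := exists_covectorForm_eq a
  have h1 : ∀ α : Fin m → ℕ, ∃ A B : ℝ, ∀ t : ℝ, pairing (c α) (multiWedge (fun i => ξ i +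
      t • Form.cast (Nat.add_sub_of_le (hk i)) (wedge (covectorForm p) (β i))) α) =
      A + t * B := by
    intro α
    have h2 : IsWedgeLine p fun t => (List.ofFn fun i => toExt n (k i) (ξ i +
        t • Form.cast (Nat.add_sub_of_le (hk i)) (wedge (covectorForm p) (β i))) ^ α i).prod := by
      refine IsWedgeLine.list_prod fun i => IsWedgeLine.pow ⟨toExt n (k i) (ξ i),
        toExt n (k i - 1) (β i), fun t => ?_⟩ (α i)
      rw [map_add, map_smul, toExt_cast, toExt_wedge, toExt_covectorForm]
    obtain ⟨x, y, hxy⟩ := h2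
    refine ⟨pairingBilin n _ (c α) (ofExt n _ x),
      pairingBilin n _ (c α) (ofExt n _ (ι ℝ p * y)), fun t => ?_⟩
    have h3 := hxy t
    beta_reduce at h3
    rw [← toExt_multiWedge (fun i => ξ i +
      t • Form.cast (Nat.add_sub_of_le (hk i)) (wedge (covectorForm p) (β i)))] at h3
    have h4 := congrArg (ofExt n (∑ i, k i * α i)) h3
    rw [ofExt_toExt] at h4
    rw [h4]
    change pairingBilin n _ (c α) _ = _
    rw [map_add, map_add, map_smul, map_smul, smul_eq_mul]
  choose A B hAB using h1
  refine ⟨AffineMap.lineMap (∑ α ∈ multiIndices n k, A α)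
    (∑ α ∈ multiIndices n k, A α + ∑ α ∈ multiIndices n k, B α), fun t => ?_⟩
  rw [hf, AffineMap.lineMap_apply_ring', Finset.sum_congr rfl fun α _ => hAB α t,
    Finset.sum_add_distrib, ← Finset.mul_sum]
  ring

/-- As every `kᵢ` is positive, `α = 0` is the only index of degree zero, and `ξ^0` does not depend
on `ξ`. The constant of `F` is thus the term `α = 0`, and the linear part of `F` splits over the
components of `T(ξ)`, each represented by a pairing. -/
theorem polyaffine_iff_pairing {n m : ℕ} {k : Fin m → ℕ} (hk : ∀ i, 1 ≤ k i)
    (f : ((i : Fin m) → Form n (k i)) → ℝ) :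
    VectoriallyExtPolyaffine k f ↔ ∃ c : (α : Fin m → ℕ) → Form n (∑ i, k i * α i),
      ∀ ξ, f ξ = ∑ α ∈ multiIndices n k, pairing (c α) (multiWedge ξ α) := by
  classical
  have hzero : (0 : Fin m → ℕ) ∈ multiIndices n k := by simp [multiIndices]
  have hne : ∀ α : Fin m → ℕ, α ≠ 0 → 1 ≤ ∑ i, k i * α i := by
    intro α hα
    obtain ⟨i, hi⟩ := Function.ne_iff.mp hα
    have : 1 ≤ k i * α i := Nat.mul_pos (hk i) (Nat.pos_of_ne_zero hi)
    exact this.trans (Finset.single_le_sum (f := fun i => k i * α i) (fun _ _ => Nat.zero_le _)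
      (Finset.mem_univ i))
  have hw : ∀ ξ : (i : Fin m) → Form n (k i), multiWedge ξ 0 = multiWedge 0 0 := by
    intro ξ
    apply toExt_injective
    rw [toExt_multiWedge, toExt_multiWedge]
    simp
  have hw0 : pairing (multiWedge (0 : (i : Fin m) → Form n (k i)) 0) (multiWedge 0 0) ≠ 0 := by
    intro h
    have h1 := toExt_multiWedge (0 : (i : Fin m) → Form n (k i)) 0
    rw [eq_zero_of_pairing_self h] at h1
    simp at h1
  have hsplit : ∀ g : (Fin m → ℕ) → ℝ, ∑ α ∈ multiIndices n k, g α =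
      g 0 + ∑ α ∈ multiIndices n k with 1 ≤ ∑ i, k i * α i, g α := by
    intro g
    rw [← Finset.add_sum_erase _ _ hzero]
    congr 2
    ext α
    simp only [Finset.mem_erase, Finset.mem_filter]
    refine ⟨fun h => ⟨h.2, hne α h.1⟩, fun h => ⟨?_, h.1⟩⟩
    rintro rfl
    simp at h
  have hfin : Finite (TIndex n k) :=
    Finite.of_injective (β := {α // α ∈ multiIndices n k}) (fun α => ⟨α.1, α.2.1⟩)
      fun α β h => Subtype.ext (Subtype.mk.inj h)
  have := Fintype.ofFinite (TIndex n k)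
  have hsub : ∀ g : (Fin m → ℕ) → ℝ,
      ∑ α ∈ multiIndices n k with 1 ≤ ∑ i, k i * α i, g α = ∑ α : TIndex n k, g α.1 :=
    fun g => Finset.sum_subtype _ (fun α => Finset.mem_filter) g
  constructor
  · rintro ⟨F, hF⟩
    choose c hc using fun α : TIndex n k => exists_pairing_eq
      (F.linear ∘ₗ LinearMap.single ℝ (fun α : TIndex n k => Form n (∑ i, k i * α.1 i)) α)
    -- The second branch matters only at `α = 0`, where it is scaled so that its pairing with `ξ^0`
    -- equals `F 0`.
    refine ⟨fun α => if h : α ∈ multiIndices n k ∧ 1 ≤ ∑ i, k i * α i then c ⟨α, h⟩ else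
      (F 0 / pairing (multiWedge (0 : (i : Fin m) → Form n (k i)) α) (multiWedge 0 α)) •
        multiWedge (0 : (i : Fin m) → Form n (k i)) α, fun ξ => ?_⟩
    rw [hsplit, hsub, hF, hw]
    have h1 : F (wedgeVector ξ) = F.linear (wedgeVector ξ) + F 0 := by
      have := F.decomp
      exact congrFun this _
    rw [h1, ← Finset.univ_sum_single (wedgeVector ξ), map_sum, add_comm]
    congr 1
    · beta_reduce
      rw [dif_neg (by simp)]
      change _ = pairingBilin n _ _ _
      rw [map_smul, LinearMap.smul_apply]
      change _ = _ * pairing _ _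
      rw [div_mul_cancel₀ _ hw0]
    · refine Finset.sum_congr rfl fun α _ => ?_
      beta_reduce
      rw [dif_pos α.2]
      exact hc α _
  · rintro ⟨c, hc⟩
    refine ⟨(∑ α : TIndex n k, pairingBilin n _ (c α.1) ∘ₗ LinearMap.proj α).toAffineMap +
      AffineMap.const ℝ _ (pairing (c 0) (multiWedge 0 0)), fun ξ => ?_⟩
    rw [hc, hsplit, hsub, hw, add_comm]
    simp only [AffineMap.coe_add, Pi.add_apply, LinearMap.coe_toAffineMap, AffineMap.const_apply,
      LinearMap.sum_apply]
    rfl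

end ExtForms

/-! ### The translation algebra and its logarithms -/

namespace ExtForms
open ExteriorAlgebra
open scoped Nat

/-- Every function `f` on a vector space is a coefficient of a representation of the translations
in a commutative algebra whose elements are determined by their action on `f`. -/
theorem exists_translation_algebra {V : Type} [AddCommGroup V] (f : V → ℝ) :
    ∃ (R : Type) (_ : CommRing R) (_ : Algebra ℝ R) (T : Multiplicative V →* R) (Φ : R →ₗ[ℝ] ℝ),
      (∀ v, Φ (T (.ofAdd v)) = f v) ∧ ∀ r, (∀ v, Φ (r * T (.ofAdd v)) = 0) → r = 0 := by
  let Φ : AddMonoidAlgebra ℝ V →ₗ[ℝ] ℝ :=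
    Finsupp.linearCombination ℝ f ∘ₗ (AddMonoidAlgebra.coeffLinearEquiv ℝ).toLinearMap
  have hΦ : ∀ v, Φ (AddMonoidAlgebra.of ℝ V (.ofAdd v)) = f v := by
    intro v
    simp [Φ]
  -- The largest ideal contained in the kernel of `Φ`. Modulo it, an element is zero once `Φ` kills
  -- all its translates.
  let I : Ideal (AddMonoidAlgebra ℝ V) :=
    { carrier := {r | ∀ s, Φ (r * s) = 0}
      add_mem' := fun {a b} ha hb s => by rw [add_mul, map_add, ha, hb, add_zero]
      zero_mem' := fun s => by rw [zero_mul, map_zero]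
      smul_mem' := fun c r hr s => by
        rw [smul_eq_mul, mul_comm c, mul_assoc]
        exact hr _ }
  have hle : Submodule.restrictScalars ℝ I ≤ LinearMap.ker Φ := fun r hr => by
    simpa using hr 1
  refine ⟨AddMonoidAlgebra ℝ V ⧸ I, inferInstance, inferInstance,
    (Ideal.Quotient.mk I).toMonoidHom.comp (AddMonoidAlgebra.of ℝ V),
    (Submodule.restrictScalars ℝ I).liftQ Φ hle, fun v => hΦ v, fun r hr => ?_⟩
  obtain ⟨r, rfl⟩ := Ideal.Quotient.mk_surjective r
  refine Ideal.Quotient.eq_zero_iff_mem.mpr fun s => ?_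
  induction s using AddMonoidAlgebra.induction_on with
  | of v => exact hr v
  | add a b ha hb => rw [mul_add, map_add, ha, hb, add_zero]
  | smul c a ha => rw [mul_smul_comm, map_smul, ha, smul_zero]

/-- The map `β ↦ p ∧ β`. -/
noncomputable def wedgeCovector {n k : ℕ} (hk : 1 ≤ k) (p : EuclideanSpace ℝ (Fin n) →L[ℝ] ℝ) :
    Form n (k - 1) →ₗ[ℝ] Form n k where
  toFun β := Form.cast (Nat.add_sub_of_le hk) (wedge (covectorForm p) β)
  map_add' a b := by
    apply toExt_injective
    simp only [map_add, toExt_cast, toExt_wedge, mul_add]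
  map_smul' c a := by
    apply toExt_injective
    simp only [map_smul, toExt_cast, toExt_wedge, mul_smul_comm, RingHom.id_apply]

theorem toExt_wedgeCovector {n k : ℕ} (hk : 1 ≤ k) (p : EuclideanSpace ℝ (Fin n) →L[ℝ] ℝ)
    (β : Form n (k - 1)) :
    toExt n k (wedgeCovector hk p β) = ι ℝ p * toExt n (k - 1) β := by
  rw [← toExt_covectorForm, ← toExt_wedge]
  exact toExt_cast _ _

/-- Vectors `(p ∧ β₁, …, p ∧ βₘ)`. -/
def IsAtom {n m : ℕ} {k : Fin m → ℕ} (hk : ∀ i, 1 ≤ k i) (v : (i : Fin m) → Form n (k i)) : Prop :=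
  ∃ (p : EuclideanSpace ℝ (Fin n) →L[ℝ] ℝ) (β : (i : Fin m) → Form n (k i - 1)),
    v = fun i => wedgeCovector (hk i) p (β i)

theorem isAtom_single_decomposable {n m : ℕ} {k : Fin m → ℕ} (hk : ∀ i, 1 ≤ k i) (i : Fin m)
    (u : Fin (k i) → EuclideanSpace ℝ (Fin n) →L[ℝ] ℝ) :
    IsAtom hk (Pi.single i (decomposable n (k i) u)) := by
  refine ⟨u ⟨0, hk i⟩, Pi.single i (decomposable n (k i - 1) fun j => u ⟨j + 1, by omega⟩), ?_⟩
  funext j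
  have h := Pi.apply_single (f' := fun j => wedgeCovector (hk j) (u ⟨0, hk i⟩))
    (fun j => map_zero _) i (decomposable n (k i - 1) fun j => u ⟨j + 1, by omega⟩) j
  rw [h, decomposable_succ (hk i)]
  rfl

section OneAffine

variable {n m : ℕ} {k : Fin m → ℕ} {hk : ∀ i, 1 ≤ k i} {R : Type} [CommRing R] [Algebra ℝ R]
  {T : Multiplicative ((i : Fin m) → Form n (k i)) →* R}

/-- `T` is affine along the lines in the directions `(p ∧ β₁, …, p ∧ βₘ)`. -/
def IsAffineOnAtoms (hk : ∀ i, 1 ≤ k i)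
    (T : Multiplicative ((i : Fin m) → Form n (k i)) →* R) : Prop :=
  ∀ v, IsAtom hk v → ∀ t : ℝ, T (.ofAdd (t • v)) = 1 + t • (T (.ofAdd v) - 1)

/-- Multiplication by `T ξ` moves the base point to `ξ`, so affinity of `f` along the parallel lines
through all base points is a single identity in `R`. -/
theorem isAffineOnAtoms_of_oneAffine {f : ((i : Fin m) → Form n (k i)) → ℝ}
    (hf : VectoriallyExtOneAffine k hk f) (Φ : R →ₗ[ℝ] ℝ) (hΦ : ∀ v, Φ (T (.ofAdd v)) = f v)
    (hR : ∀ r, (∀ v, Φ (r * T (.ofAdd v)) = 0) → r = 0) : IsAffineOnAtoms hk T := by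
  rintro v ⟨p, β, rfl⟩ t
  rw [← sub_eq_zero]
  refine hR _ fun ξ => ?_
  obtain ⟨g, hg⟩ := hf ξ (covectorForm p) β
  have h0 : ∀ s : ℝ, g s = g 0 + s * (g 1 - g 0) := by
    intro s
    have := g.apply_lineMap 0 1 s
    rw [AffineMap.lineMap_apply_ring', AffineMap.lineMap_apply_ring'] at this
    simp only [sub_zero, mul_one, add_zero] at this
    rw [this]
    ring
  have h1 : ∀ s : ℝ, Φ (T (.ofAdd (s • fun i => wedgeCovector (hk i) p (β i))) * T (.ofAdd ξ)) =
      g s := by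
    intro s
    rw [← map_mul, ← ofAdd_add, hΦ, ← hg, add_comm]
    rfl
  have h2 := h1 t
  have h3 := h1 1
  have h4 := h1 0
  rw [one_smul] at h3
  rw [zero_smul, ofAdd_zero, map_one, one_mul] at h4
  rw [sub_mul, add_mul, smul_mul_assoc, sub_mul, one_mul, map_sub Φ, map_add Φ,
    map_smul Φ, map_sub Φ, h2, h3, h4, h0 t, smul_eq_mul]
  ring

theorem eq_zero_of_two_mul {x : R} (h : 2 * x = 0) : x = 0 := by
  have h2 : algebraMap ℝ R (1 / 2) * 2 = 1 := by
    rw [← map_ofNat (algebraMap ℝ R) 2, ← map_mul]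
    norm_num
  rw [← one_mul x, ← h2, mul_assoc, h, mul_zero]

/-- Take `t = 2`: then `T(2v) = T(v)²` must equal `2 T(v) - 1`. -/
theorem IsAffineOnAtoms.sq (hT : IsAffineOnAtoms hk T) {v : (i : Fin m) → Form n (k i)}
    (hv : IsAtom hk v) : (T (.ofAdd v) - 1) ^ 2 = 0 := by
  have h := hT v hv 2
  rw [two_smul, ofAdd_add, map_mul, two_smul] at h
  linear_combination h

/-- With `x = T(v) - 1` and `y = T(w) - 1` of square zero, `T(v + w) - 1 = x + y + xy` has square
`2xy`, which must vanish too. -/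
theorem IsAffineOnAtoms.mul_eq_zero (hT : IsAffineOnAtoms hk T)
    {v w : (i : Fin m) → Form n (k i)} (hv : IsAtom hk v) (hw : IsAtom hk w)
    (hvw : IsAtom hk (v + w)) : (T (.ofAdd v) - 1) * (T (.ofAdd w) - 1) = 0 := by
  have h1 := hT.sq hv
  have h2 := hT.sq hw
  have h3 := hT.sq hvw
  rw [ofAdd_add, map_mul] at h3
  apply eq_zero_of_two_mul
  generalize T (.ofAdd v) = a at *
  generalize T (.ofAdd w) = b at *
  linear_combination h3 - (2 * b - 1 + (b - 1) ^ 2) * h1 - (2 * a - 1) * h2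

theorem IsAffineOnAtoms.add (hT : IsAffineOnAtoms hk T)
    {v w : (i : Fin m) → Form n (k i)} (hv : IsAtom hk v) (hw : IsAtom hk w)
    (hvw : IsAtom hk (v + w)) :
    T (.ofAdd (v + w)) - 1 = (T (.ofAdd v) - 1) + (T (.ofAdd w) - 1) := by
  have h := hT.mul_eq_zero hv hw hvw
  rw [ofAdd_add, map_mul]
  linear_combination h

/-- The increments of `T` along decomposable forms in the `i`-th slot. -/
noncomputable def increment (hT : IsAffineOnAtoms hk T) (i : Fin m) :
    (EuclideanSpace ℝ (Fin n) →L[ℝ] ℝ) [⋀^Fin (k i)]→ₗ[ℝ] R where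
  toFun u := T (.ofAdd (Pi.single i (decomposable n (k i) u))) - 1
  -- The two summands and their sum are all decomposable, hence atoms, as the additivity of
  -- increments requires.
  map_update_add' u j x y := by
    have h := hT.add (isAtom_single_decomposable hk i (Function.update u j x))
      (isAtom_single_decomposable hk i (Function.update u j y))
    rw [← Pi.single_add, ← AlternatingMap.map_update_add] at h
    convert! h (isAtom_single_decomposable hk i _)
  map_update_smul' u j c x := by
    have h := hT _ (isAtom_single_decomposable hk i (Function.update u j x)) c
    rw [← Pi.single_smul, ← AlternatingMap.map_update_smul] at h
    have h2 := sub_eq_of_eq_add' h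
    convert! h2
  map_eq_zero_of_eq' u a b hab hne := by
    change T (.ofAdd (Pi.single i (decomposable n (k i) u))) - 1 = 0
    rw [(decomposable n (k i)).map_eq_zero_of_eq u hab hne, Pi.single_zero, ofAdd_zero, map_one,
      sub_self]

/-- The extension of `increment` to the exterior algebra. -/
noncomputable def logT (hT : IsAffineOnAtoms hk T) (i : Fin m) : DualExt n →ₗ[ℝ] R :=
  liftAlternating (Function.update 0 (k i) (increment hT i))

theorem logT_ιMulti_of_ne (hT : IsAffineOnAtoms hk T) (i : Fin m) {r : ℕ} (h : r ≠ k i)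
    (u : Fin r → EuclideanSpace ℝ (Fin n) →L[ℝ] ℝ) : logT hT i (ιMulti ℝ r u) = 0 := by
  rw [logT, liftAlternating_apply_ιMulti, Function.update_of_ne h]
  rfl

theorem logT_ιMulti (hT : IsAffineOnAtoms hk T) (i : Fin m) {r : ℕ} (h : r = k i)
    (u : Fin r → EuclideanSpace ℝ (Fin n) →L[ℝ] ℝ) : logT hT i (ιMulti ℝ r u) =
      T (.ofAdd (Pi.single i (ofExt n (k i) (ιMulti ℝ r u)))) - 1 := by
  subst h
  rw [logT, liftAlternating_apply_ιMulti, Function.update_self]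
  rfl

theorem exists_logT_ι_mul (hT : IsAffineOnAtoms hk T) (i : Fin m)
    (p : EuclideanSpace ℝ (Fin n) →L[ℝ] ℝ) {r : ℕ}
    (u : Fin r → EuclideanSpace ℝ (Fin n) →L[ℝ] ℝ) :
    ∃ β, logT hT i (ι ℝ p * ιMulti ℝ r u) =
      T (.ofAdd (Pi.single i (wedgeCovector (hk i) p β))) - 1 := by
  have h1 : ι ℝ p * ιMulti ℝ r u = ιMulti ℝ (r + 1) (Matrix.vecCons p u) := by
    rw [ιMulti_succ_apply]
    rfl
  by_cases h : r + 1 = k i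
  · obtain rfl : r = k i - 1 := by omega
    refine ⟨decomposable n (k i - 1) u, ?_⟩
    rw [h1, logT_ιMulti hT i h, ← h1, ← toExt_decomposable, ← toExt_wedgeCovector (hk i),
      ofExt_toExt]
  · refine ⟨0, ?_⟩
    rw [h1, logT_ιMulti_of_ne hT i h, map_zero, Pi.single_zero, ofAdd_zero, map_one, sub_self]

theorem span_ιMulti_induction {P : DualExt n → Prop}
    (h1 : ∀ r (u : Fin r → EuclideanSpace ℝ (Fin n) →L[ℝ] ℝ), P (ιMulti ℝ r u)) (h0 : P 0)
    (hadd : ∀ x y, P x → P y → P (x + y)) (hsmul : ∀ (c : ℝ) x, P x → P (c • x)) (x : DualExt n) :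
    P x := by
  have hx : x ∈ Submodule.span ℝ (Set.range fun x : Σ n', (Fin n' →
      EuclideanSpace ℝ (Fin n) →L[ℝ] ℝ) => ιMulti ℝ x.1 x.2) := by
    rw [ιMulti_span]; trivial
  induction hx using Submodule.span_induction with
  | mem x hx => obtain ⟨⟨r, u⟩, rfl⟩ := hx; exact h1 r u
  | zero => exact h0
  | add x y _ _ hx hy => exact hadd x y hx hy
  | smul c x _ hx => exact hsmul c x hx

/-- The products `L (p ∧ x) K (p ∧ y)` vanish. -/
def Annihilate (L K : DualExt n →ₗ[ℝ] R) : Prop :=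
  ∀ (p : EuclideanSpace ℝ (Fin n) →L[ℝ] ℝ) (x y : DualExt n), L (ι ℝ p * x) * K (ι ℝ p * y) = 0

theorem annihilate_of_ιMulti {L K : DualExt n →ₗ[ℝ] R}
    (h : ∀ (p : EuclideanSpace ℝ (Fin n) →L[ℝ] ℝ) (r s : ℕ)
      (u : Fin r → EuclideanSpace ℝ (Fin n) →L[ℝ] ℝ) (w : Fin s → EuclideanSpace ℝ (Fin n) →L[ℝ] ℝ),
      L (ι ℝ p * ιMulti ℝ r u) * K (ι ℝ p * ιMulti ℝ s w) = 0) : Annihilate L K := by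
  intro p x y
  induction x using span_ιMulti_induction with
  | h0 => simp
  | hadd a b ha hb => rw [mul_add, map_add, add_mul, ha, hb, add_zero]
  | hsmul c a ha => rw [mul_smul_comm, map_smul, smul_mul_assoc, ha, smul_zero]
  | h1 r u =>
    induction y using span_ιMulti_induction with
    | h0 => simp
    | hadd a b ha hb => rw [mul_add, map_add, mul_add, ha, hb, add_zero]
    | hsmul c a ha => rw [mul_smul_comm, map_smul, mul_smul_comm, ha, smul_zero]
    | h1 s w => exact h p r s u w

/-- Atoms with a common covector `p` form a linear space, even across different slots, so
`IsAffineOnAtoms.mul_eq_zero` applies to them. -/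
theorem annihilate_logT (hT : IsAffineOnAtoms hk T) (i j : Fin m) :
    Annihilate (logT hT i) (logT hT j) := by
  refine annihilate_of_ιMulti fun p r s u w => ?_
  obtain ⟨β, hβ⟩ := exists_logT_ι_mul hT i p u
  obtain ⟨γ, hγ⟩ := exists_logT_ι_mul hT j p w
  have hs : ∀ (i : Fin m) (β : Form n (k i - 1)), (Pi.single i (wedgeCovector (hk i) p β) :
      (i : Fin m) → Form n (k i)) = fun j => wedgeCovector (hk j) p
        ((Pi.single i β : (i : Fin m) → Form n (k i - 1)) j) := by
    intro i β
    funext j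
    exact (Pi.apply_single (f' := fun j => wedgeCovector (hk j) p) (fun j => map_zero _) i β j).symm
  rw [hβ, hγ]
  refine hT.mul_eq_zero ⟨p, _, hs i β⟩ ⟨p, _, hs j γ⟩ ⟨p, Pi.single i β + Pi.single j γ, ?_⟩
  rw [hs, hs]
  funext l
  simp only [Pi.add_apply, map_add]

theorem exists_ιMulti_eq_ι_mul {r : ℕ} (u : Fin r → EuclideanSpace ℝ (Fin n) →L[ℝ] ℝ)
    (a : Fin r) : ∃ x, ιMulti ℝ r u = ι ℝ (u a) * x := by
  obtain ⟨r, rfl⟩ : ∃ r', r = r' + 1 := ⟨r - 1, by have := a.2; omega⟩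
  have h := (ιMulti ℝ (r + 1)).map_insertNth a (u a) (a.removeNth u)
  rw [Fin.insertNth_self_removeNth, ιMulti_succ_apply (Matrix.vecCons _ _)] at h
  refine ⟨(-1 : ℤ) ^ (a : ℕ) • ιMulti ℝ r (Matrix.vecTail (Matrix.vecCons (u a) (a.removeNth u))), ?_⟩
  rw [h, mul_smul_comm]
  rfl

/-- The product of two linear functions of exterior degrees `p` and `q` which annihilate each
other, as an alternating function of `p + q` covectors. -/
noncomputable def mulAlternating (p q : ℕ) (L K : DualExt n →ₗ[ℝ] R) (h : Annihilate L K) :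
    (EuclideanSpace ℝ (Fin n) →L[ℝ] ℝ) [⋀^Fin p ⊕ Fin q]→ₗ[ℝ] R :=
  { (LinearMap.mul' ℝ R).compMultilinearMap (MultilinearMap.domCoprod
      (L.compAlternatingMap (ιMulti ℝ p)).toMultilinearMap
      (K.compAlternatingMap (ιMulti ℝ q)).toMultilinearMap) with
    map_eq_zero_of_eq' := by
      intro u a b hab hne
      change L (ιMulti ℝ p fun i => u (.inl i)) * K (ιMulti ℝ q fun i => u (.inr i)) = 0
      rcases a with a | a <;> rcases b with b | b
      · rw [(ιMulti ℝ p).map_eq_zero_of_eq (fun i => u (.inl i)) (i := a) (j := b) hab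
          fun h => hne (by rw [h]), map_zero, zero_mul]
      · obtain ⟨x, hx⟩ := exists_ιMulti_eq_ι_mul (fun i => u (.inl i)) a
        obtain ⟨y, hy⟩ := exists_ιMulti_eq_ι_mul (fun i => u (.inr i)) b
        rw [hx, hy, hab]
        exact h _ _ _
      · obtain ⟨x, hx⟩ := exists_ιMulti_eq_ι_mul (fun i => u (.inl i)) b
        obtain ⟨y, hy⟩ := exists_ιMulti_eq_ι_mul (fun i => u (.inr i)) a
        rw [hx, hy, hab]
        exact h _ _ _
      · rw [(ιMulti ℝ q).map_eq_zero_of_eq (fun i => u (.inr i)) (i := a) (j := b) hab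
          fun h => hne (by rw [h]), map_zero, mul_zero] }

/-- A covector repeated within a block kills one factor, and one shared by both blocks kills the
product by `Annihilate`. So the product is alternating in all `p + q` covectors and factors through
the wedge. The last clause is what permits iteration. -/
theorem exists_mul_extension (p q : ℕ) (L K : DualExt n →ₗ[ℝ] R) (h : Annihilate L K) :
    ∃ N : DualExt n →ₗ[ℝ] R,
      (∀ x ∈ ⋀[ℝ]^p (EuclideanSpace ℝ (Fin n) →L[ℝ] ℝ),
        ∀ y ∈ ⋀[ℝ]^q (EuclideanSpace ℝ (Fin n) →L[ℝ] ℝ), N (x * y) = L x * K y) ∧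
      ∀ J : DualExt n →ₗ[ℝ] R, Annihilate L J → Annihilate K J → Annihilate N J := by
  let N : DualExt n →ₗ[ℝ] R := liftAlternating (Function.update 0 (p + q)
    ((mulAlternating p q L K h).domDomCongr finSumFinEquiv))
  have hN : ∀ x ∈ ⋀[ℝ]^p (EuclideanSpace ℝ (Fin n) →L[ℝ] ℝ),
        ∀ y ∈ ⋀[ℝ]^q (EuclideanSpace ℝ (Fin n) →L[ℝ] ℝ), N (x * y) = L x * K y := by
    intro x hx y hy
    rw [← ιMulti_span_fixedDegree] at hx hy
    induction hx using Submodule.span_induction with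
    | zero => simp
    | add a b _ _ ha hb => rw [add_mul, map_add, map_add, add_mul, ha, hb]
    | smul c a _ ha => rw [smul_mul_assoc, map_smul, map_smul, smul_mul_assoc, ha]
    | mem x hx =>
      obtain ⟨u, rfl⟩ := hx
      induction hy using Submodule.span_induction with
      | zero => simp
      | add a b _ _ ha hb => rw [mul_add, map_add, map_add, mul_add, ha, hb]
      | smul c a _ ha => rw [mul_smul_comm, map_smul, map_smul, mul_smul_comm, ha]
      | mem y hy =>
        obtain ⟨w, rfl⟩ := hy
        rw [ιMulti_mul_ιMulti]
        simp only [N, liftAlternating_apply_ιMulti, Function.update_self]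
        change L (ιMulti ℝ p fun i => Fin.append u w (finSumFinEquiv (.inl i))) *
          K (ιMulti ℝ q fun i => Fin.append u w (finSumFinEquiv (.inr i))) = _
        simp
  refine ⟨N, hN, fun J hL hK => annihilate_of_ιMulti fun c r s u w => ?_⟩
  have h1 : ι ℝ c * ιMulti ℝ r u = ιMulti ℝ (r + 1) (Matrix.vecCons c u) := by
    rw [ιMulti_succ_apply]
    rfl
  by_cases hr : r + 1 = p + q
  -- The leading covector `c` belongs to the left block, unless that block is empty; it then leads
  -- the right block, and annihilation is taken from `K` instead of `L`.
  · rcases p with _ | p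
    · have h2 : ι ℝ c * ιMulti ℝ r u ∈ ⋀[ℝ]^q (EuclideanSpace ℝ (Fin n) →L[ℝ] ℝ) := by
        obtain rfl : r + 1 = q := by omega
        rw [h1]
        exact ιMulti_range ℝ _ ⟨_, rfl⟩
      have h3 := hN 1 (ιMulti_range ℝ 0 ⟨Fin.elim0, ιMulti_zero_apply _⟩) _ h2
      rw [one_mul] at h3
      rw [h3, mul_assoc, hK, mul_zero]
    · obtain rfl : r = p + q := by omega
      have h2 : ι ℝ c * ιMulti ℝ (p + q) u =
          ιMulti ℝ (p + 1) (Matrix.vecCons c fun i => u (Fin.castAdd q i)) *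
            ιMulti ℝ q fun i => u (Fin.natAdd p i) := by
        rw [ιMulti_succ_apply, mul_assoc]
        change _ = ι ℝ c * (ιMulti ℝ p (fun i => u (Fin.castAdd q i)) *
            ιMulti ℝ q fun i => u (Fin.natAdd p i))
        rw [ιMulti_mul_ιMulti, Fin.append_castAdd_natAdd]
      rw [h2, hN _ (ιMulti_range ℝ _ ⟨_, rfl⟩) _ (ιMulti_range ℝ _ ⟨_, rfl⟩), ιMulti_succ_apply,
        mul_right_comm]
      rw [show (Matrix.vecCons c fun i => u (Fin.castAdd q i) : Fin (p + 1) → _) 0 = c from rfl, hL,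
        zero_mul]
  · have h2 : N (ι ℝ c * ιMulti ℝ r u) = 0 := by
      rw [h1]
      simp only [N, liftAlternating_apply_ιMulti, Function.update_of_ne hr]
      rfl
    rw [h2, zero_mul]

end OneAffine

end ExtForms

/-! ### The exponential formula and (iii) ⇒ (iv) -/

namespace ExtForms
open ExteriorAlgebra
open scoped Nat

section Representation

variable {n m : ℕ} {k : Fin m → ℕ} {hk : ∀ i, 1 ≤ k i} {R : Type} [CommRing R] [Algebra ℝ R]
  {T : Multiplicative ((i : Fin m) → Form n (k i)) →* R}

/-- `P ξ` is a fixed linear function of the element `X ξ` of degree `p`. -/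
def IsRepresented {n m : ℕ} {k : Fin m → ℕ} {hk : ∀ i, 1 ≤ k i} {R : Type} [CommRing R]
    [Algebra ℝ R] {T : Multiplicative ((i : Fin m) → Form n (k i)) →* R}
    (hT : IsAffineOnAtoms hk T) (p : ℕ) (X : ((i : Fin m) → Form n (k i)) → DualExt n)
    (P : ((i : Fin m) → Form n (k i)) → R) : Prop :=
  (∀ ξ, X ξ ∈ ⋀[ℝ]^p (EuclideanSpace ℝ (Fin n) →L[ℝ] ℝ)) ∧
    ∃ L : DualExt n →ₗ[ℝ] R, (∀ ξ, P ξ = L (X ξ)) ∧ ∀ j, Annihilate L (logT hT j)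

theorem IsRepresented.one (hT : IsAffineOnAtoms hk T) :
    IsRepresented hT 0 (fun _ => 1) fun _ => 1 := by
  refine ⟨fun ξ => ιMulti_range ℝ 0 ⟨Fin.elim0, ιMulti_zero_apply _⟩,
    (Algebra.linearMap ℝ R) ∘ₗ algebraMapInv.toLinearMap, fun ξ => by simp, fun j p x y => ?_⟩
  simp [algebraMapInv]

theorem IsRepresented.mul {hT : IsAffineOnAtoms hk T} {p : ℕ}
    {X : ((i : Fin m) → Form n (k i)) → DualExt n} {P : ((i : Fin m) → Form n (k i)) → R}
    (h : IsRepresented hT p X P) (i : Fin m) :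
    IsRepresented hT (p + k i) (fun ξ => X ξ * toExt n (k i) (ξ i))
      fun ξ => P ξ * logT hT i (toExt n (k i) (ξ i)) := by
  obtain ⟨hX, L, hL, hA⟩ := h
  obtain ⟨N, hN, hN'⟩ := exists_mul_extension p (k i) L (logT hT i) (hA i)
  refine ⟨fun ξ => ?_, N, fun ξ => ?_, fun j => hN' _ (hA j) (annihilate_logT hT i j)⟩
  · exact SetLike.mul_mem_graded (A := fun i => ⋀[ℝ]^i (EuclideanSpace ℝ (Fin n) →L[ℝ] ℝ))
      (hX ξ) (toExt_mem_exteriorPower (ξ i))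
  · beta_reduce
    rw [hL, hN _ (hX ξ) _ (toExt_mem_exteriorPower (ξ i))]

theorem IsRepresented.mul_pow {hT : IsAffineOnAtoms hk T} {p : ℕ}
    {X : ((i : Fin m) → Form n (k i)) → DualExt n} {P : ((i : Fin m) → Form n (k i)) → R}
    (h : IsRepresented hT p X P) (i : Fin m) (a : ℕ) :
    IsRepresented hT (p + k i * a) (fun ξ => X ξ * toExt n (k i) (ξ i) ^ a)
      fun ξ => P ξ * logT hT i (toExt n (k i) (ξ i)) ^ a := by
  induction a with
  | zero => simpa using h
  | succ a ih =>
    simp only [pow_succ, ← mul_assoc, Nat.mul_succ, ← add_assoc]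
    exact ih.mul i

/-- The slots are listed by an arbitrary sequence `s`, so that the induction can drop a factor while
`ξ` keeps all its components. -/
theorem IsRepresented.list_prod (hT : IsAffineOnAtoms hk T) :
    ∀ {l : ℕ} (s : Fin l → Fin m) (α : Fin l → ℕ),
      IsRepresented hT (∑ j, k (s j) * α j)
        (fun ξ => (List.ofFn fun j => toExt n (k (s j)) (ξ (s j)) ^ α j).prod)
        fun ξ => ∏ j, logT hT (s j) (toExt n (k (s j)) (ξ (s j))) ^ α j
  | 0, _, _ => by simpa using IsRepresented.one hT
  | l + 1, s, α => by
    simp only [List.ofFn_succ', List.prod_concat, Fin.sum_univ_castSucc, Fin.prod_univ_castSucc]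
    exact (IsRepresented.list_prod hT (fun j : Fin l => s j.castSucc)
      fun j => α j.castSucc).mul_pow _ _

theorem IsRepresented.eq_zero {hT : IsAffineOnAtoms hk T} {p : ℕ}
    {X : ((i : Fin m) → Form n (k i)) → DualExt n} {P : ((i : Fin m) → Form n (k i)) → R}
    (h : IsRepresented hT p X P) (hp : n < p) (ξ : (i : Fin m) → Form n (k i)) : P ξ = 0 := by
  obtain ⟨hX, L, hL, -⟩ := h
  rw [hL, exteriorPower_eq_bot hp (hX ξ), map_zero]

/-- This power is a linear function of an element of degree `kᵢ ([n / kᵢ] + 1) > n`. -/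
theorem logT_pow_eq_zero (hT : IsAffineOnAtoms hk T) (i : Fin m) (η : Form n (k i)) :
    logT hT i (toExt n (k i) η) ^ (n / k i + 1) = 0 := by
  have h := (IsRepresented.one hT).mul_pow i (n / k i + 1)
  have h2 := h.eq_zero (by rw [zero_add]; exact Nat.lt_mul_div_succ n (hk i)) (Pi.single i η)
  simpa using h2

/-- Both sides turn sums into products, so decomposable forms suffice. There the increment has
square zero, and the exponential series stops after the linear term. -/
theorem map_single_eq_exp [Module ℚ R] (hT : IsAffineOnAtoms hk T) (i : Fin m)
    (η : Form n (k i)) :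
    T (.ofAdd (Pi.single i η)) = IsNilpotent.exp (logT hT i (toExt n (k i) η)) := by
  have hnil : ∀ η, IsNilpotent (logT hT i (toExt n (k i) η)) :=
    fun η => ⟨_, logT_pow_eq_zero hT i η⟩
  have hη : η ∈ Submodule.span ℝ (Set.range (decomposable n (k i))) := by
    rw [span_decomposable]; trivial
  -- Neither side is homogeneous in `η`, so the scalar has to be carried through the induction over
  -- the span.
  suffices ∀ c : ℝ, T (.ofAdd (Pi.single i (c • η))) =
      IsNilpotent.exp (logT hT i (toExt n (k i) (c • η))) by simpa using this 1
  induction hη using Submodule.span_induction with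
  | zero => intro c; simp [IsNilpotent.exp_zero]
  | smul a x _ hx => intro c; rw [smul_smul]; exact hx _
  | add x y _ _ hx hy =>
    intro c
    rw [smul_add, Pi.single_add, ofAdd_add, map_mul, map_add, map_add,
      IsNilpotent.exp_add_of_commute (Commute.all _ _) (hnil _) (hnil _), hx, hy]
  | mem x hx =>
    obtain ⟨u, rfl⟩ := hx
    intro c
    have hat := isAtom_single_decomposable hk i u
    have h1 : logT hT i (toExt n (k i) (decomposable n (k i) u)) =
        T (.ofAdd (Pi.single i (decomposable n (k i) u))) - 1 := by
      rw [toExt_decomposable, logT_ιMulti hT i rfl]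
      rfl
    rw [Pi.single_smul, hT _ hat, map_smul, map_smul, h1,
      IsNilpotent.exp_eq_sum (k := 2) (by rw [smul_pow, hT.sq hat, smul_zero])]
    simp [Finset.sum_range_succ]

theorem map_single_eq_sum (hT : IsAffineOnAtoms hk T) (i : Fin m) (η : Form n (k i)) :
    T (.ofAdd (Pi.single i η)) = ∑ a ∈ Finset.range (n / k i + 1),
      (a ! : ℝ)⁻¹ • logT hT i (toExt n (k i) η) ^ a := by
  let _ : Module ℚ R := Module.compHom R (algebraMap ℚ ℝ)
  rw [map_single_eq_exp hT, IsNilpotent.exp_eq_sum (logT_pow_eq_zero hT i η)]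
  refine Finset.sum_congr rfl fun a _ => ?_
  rw [← Rat.cast_smul_eq_qsmul ℝ]
  push_cast
  rfl

end Representation

theorem exists_pairing_of_oneAffine {n m : ℕ} {k : Fin m → ℕ} {hk : ∀ i, 1 ≤ k i}
    {f : ((i : Fin m) → Form n (k i)) → ℝ} (hf : VectoriallyExtOneAffine k hk f) :
    ∃ c : (α : Fin m → ℕ) → Form n (∑ i, k i * α i),
      ∀ ξ, f ξ = ∑ α ∈ multiIndices n k, pairing (c α) (multiWedge ξ α) := by
  obtain ⟨R, _, _, T, Φ, hΦ, hR⟩ := exists_translation_algebra f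
  have hT : IsAffineOnAtoms hk T := isAffineOnAtoms_of_oneAffine hf Φ hΦ hR
  have hrep := fun α : Fin m → ℕ => IsRepresented.list_prod hT id α
  choose L hL hA using fun α => (hrep α).2
  choose c hc using fun α : Fin m → ℕ => exists_pairing_eq
    ((∏ i, ((α i)! : ℝ)⁻¹) • (Φ ∘ₗ L α ∘ₗ toExt n (∑ i, k i * α i)))
  refine ⟨c, fun ξ => ?_⟩
  have h1 : T (.ofAdd ξ) = ∑ α ∈ Fintype.piFinset fun i => Finset.range (n / k i + 1),
      (∏ i, ((α i)! : ℝ)⁻¹) • ∏ i, logT hT i (toExt n (k i) (ξ i)) ^ α i := by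
    conv_lhs => rw [← Finset.univ_sum_single ξ, ofAdd_sum, map_prod]
    simp only [map_single_eq_sum hT, Finset.prod_univ_sum]
    refine Finset.sum_congr rfl fun α _ => ?_
    rw [Finset.prod_smul]
  have h2 : ∀ α, Φ ((∏ i, ((α i)! : ℝ)⁻¹) • ∏ i, logT hT i (toExt n (k i) (ξ i)) ^ α i) =
      pairing (c α) (multiWedge ξ α) := by
    intro α
    have h2 := hL α ξ
    simp only [id] at h2
    rw [← hc, map_smul, h2, ← toExt_multiWedge]
    rfl
  rw [← hΦ, h1, map_sum, multiIndices, Finset.sum_filter_of_ne]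
  · exact Finset.sum_congr rfl fun α _ => h2 α
  -- The product of exponentials runs over the full box of multi-indices; those with `|kα| > n`
  -- contribute nothing because `ξ^α = 0`.
  · intro α _ hne
    by_contra hlt
    refine hne ?_
    rw [← hc]
    have h3 := toExt_mem_exteriorPower (multiWedge ξ α)
    simp [exteriorPower_eq_bot (not_le.mp hlt) h3]

end ExtForms

/-! ### Smoothness, and the null Lagrangian property for test functions -/

namespace ExtForms


section Smooth

open scoped Nat

variable {n : ℕ} {X : Type*} [NormedAddCommGroup X] [NormedSpace ℝ X]

theorem contDiff_wedge_apply {p q : ℕ} {a : X → Form n p} {b : X → Form n q}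
    (ha : ∀ v, ContDiff ℝ (⊤ : ℕ∞) fun x => a x v) (hb : ∀ v, ContDiff ℝ (⊤ : ℕ∞) fun x => b x v)
    (v : Fin (p + q) → EuclideanSpace ℝ (Fin n)) :
    ContDiff ℝ (⊤ : ℕ∞) fun x => wedge (a x) (b x) v := by
  have h : (fun x => wedge (a x) (b x) v) = fun x => (p ! * q ! : ℝ)⁻¹ *
      ∑ σ : Equiv.Perm (Fin p ⊕ Fin q), ((Equiv.Perm.sign σ : ℤ) : ℝ) *
        (a x (fun i => v (finSumFinEquiv (σ (.inl i)))) *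
        b x (fun i => v (finSumFinEquiv (σ (.inr i))))) := by
    funext x
    rw [← wedge_apply, inv_mul_cancel_left₀ (by positivity)]
  rw [h]
  exact contDiff_const.mul (ContDiff.sum fun σ _ => contDiff_const.mul ((ha _).mul (hb _)))

theorem contDiff_wedgePow_apply {k : ℕ} {ξ : X → Form n k}
    (hξ : ∀ v, ContDiff ℝ (⊤ : ℕ∞) fun x => ξ x v) :
    ∀ (a : ℕ) (v : Fin (k * a) → EuclideanSpace ℝ (Fin n)),
      ContDiff ℝ (⊤ : ℕ∞) fun x => wedgePow (ξ x) a v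
  | 0, _ => contDiff_const
  | a + 1, v => contDiff_wedge_apply (contDiff_wedgePow_apply hξ a) hξ v

theorem contDiff_wedgeProd_apply : ∀ {m : ℕ} {d : Fin m → ℕ} {ξ : X → (i : Fin m) → Form n (d i)}
    (_ : ∀ i v, ContDiff ℝ (⊤ : ℕ∞) fun x => ξ x i v)
    (v : Fin (∑ i, d i) → EuclideanSpace ℝ (Fin n)),
      ContDiff ℝ (⊤ : ℕ∞) fun x => wedgeProd (ξ x) v
  | 0, _, _, _, _ => contDiff_const
  | _ + 1, _, _, h, _ => contDiff_wedge_apply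
      (contDiff_wedgeProd_apply fun i v => h i.castSucc v) (h (Fin.last _)) _

end Smooth

theorem contDiff_of_pairing {n m : ℕ} {k : Fin m → ℕ}
    {f : ((i : Fin m) → Form n (k i)) → ℝ} {c : (α : Fin m → ℕ) → Form n (∑ i, k i * α i)}
    (hf : ∀ ξ, f ξ = ∑ α ∈ multiIndices n k, pairing (c α) (multiWedge ξ α)) :
    ContDiff ℝ (⊤ : ℕ∞) f := by
  rw [funext hf]
  refine ContDiff.sum fun α _ => ContDiff.sum fun I _ => contDiff_const.mul ?_
  refine contDiff_wedgeProd_apply (fun i v => contDiff_wedgePow_apply (fun v => ?_) _ v) _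
  let L : ((i : Fin m) → Form n (k i)) →ₗ[ℝ] ℝ :=
    { toFun := fun ξ => ξ i v
      map_add' := fun _ _ => rfl
      map_smul' := fun _ _ => rfl }
  exact (LinearMap.toContinuousLinearMap L).contDiff

section NullLagrangian

variable {n : ℕ} {U V : Type*} [NormedAddCommGroup U] [NormedSpace ℝ U] [NormedAddCommGroup V]
  [NormedSpace ℝ V]

theorem two_le_top : (2 : WithTop ℕ∞) ≤ ((⊤ : ℕ∞) : WithTop ℕ∞) :=
  WithTop.coe_le_coe.mpr (le_top : (2 : ℕ∞) ≤ ⊤)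

theorem integral_fderiv_apply_eq_zero {g : EuclideanSpace ℝ (Fin n) → ℝ} (hg : ContDiff ℝ 1 g)
    (hc : HasCompactSupport g) (v : EuclideanSpace ℝ (Fin n)) : ∫ x, fderiv ℝ g x v = 0 := by
  have h1 : Continuous fun x => fderiv ℝ g x v :=
    (hg.continuous_fderiv one_ne_zero).clm_apply continuous_const
  have h2 : HasCompactSupport fun x => fderiv ℝ g x v := hc.fderiv_apply ℝ v
  have h := integral_mul_fderiv_eq_neg_fderiv_mul_of_integrable (μ := volume) (𝕜 := ℝ)
    (f := fun _ : EuclideanSpace ℝ (Fin n) => (1 : ℝ)) (g := g) (v := v) (by simp)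
    (by simpa using h1.integrable_of_hasCompactSupport h2)
    (by simpa using hg.continuous.integrable_of_hasCompactSupport hc)
    (fun _ _ => differentiableAt_const _)
    (fun _ _ => (hg.differentiable one_ne_zero).differentiableAt)
  simpa using h

theorem clm_eq_sum_smulRight (G : EuclideanSpace ℝ (Fin n) →L[ℝ] U) :
    G = ∑ j, (EuclideanSpace.proj j : EuclideanSpace ℝ (Fin n) →L[ℝ] ℝ).smulRight
      (G (EuclideanSpace.single j 1)) := by
  ext v
  have hv : v = ∑ j, v j • EuclideanSpace.single j (1 : ℝ) := by
    ext l
    simp [Pi.single_apply]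
  conv_lhs => rw [hv]
  simp

/-- The second derivative of `f` vanishes on the cone of the vectors `D (p ⊗ u)`. -/
def IsFlatOnCone (f : V → ℝ) (D : (EuclideanSpace ℝ (Fin n) →L[ℝ] U) →L[ℝ] V) : Prop :=
  ∀ (η : V) (p : EuclideanSpace ℝ (Fin n) →L[ℝ] ℝ) (u : U),
    fderiv ℝ (fderiv ℝ f) η (D (p.smulRight u)) (D (p.smulRight u)) = 0

/-- Polarizing in `u` and then in `p` shows that the second derivative on `p ⊗ u`, `q ⊗ w` is
antisymmetric under exchanging `p` and `q`. -/
theorem IsFlatOnCone.polarized {f : V → ℝ} {D : (EuclideanSpace ℝ (Fin n) →L[ℝ] U) →L[ℝ] V}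
    (h : IsFlatOnCone f D) (hf : ContDiff ℝ 2 f) (η : V)
    (p q : EuclideanSpace ℝ (Fin n) →L[ℝ] ℝ) (u w : U) :
    fderiv ℝ (fderiv ℝ f) η (D (p.smulRight u)) (D (q.smulRight w)) +
      fderiv ℝ (fderiv ℝ f) η (D (q.smulRight u)) (D (p.smulRight w)) = 0 := by
  have hs : ∀ v w, fderiv ℝ (fderiv ℝ f) η v w = fderiv ℝ (fderiv ℝ f) η w v :=
    (hf.contDiffAt.isSymmSndFDerivAt (by simp)).eq
  have h1 : ∀ (p : EuclideanSpace ℝ (Fin n) →L[ℝ] ℝ) (u w : U),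
      fderiv ℝ (fderiv ℝ f) η (D (p.smulRight u)) (D (p.smulRight w)) = 0 := by
    intro p u w
    have h2 := h η p (u + w)
    have h3 : p.smulRight (u + w) = p.smulRight u + p.smulRight w := by ext v; simp
    rw [h3] at h2
    simp only [map_add, add_apply, h η p u, h η p w] at h2
    rw [hs (D (p.smulRight w))] at h2
    linarith
  have h2 := h1 (p + q) u w
  have h3 : ∀ u : U, (p + q).smulRight u = p.smulRight u + q.smulRight u := by
    intro u; ext v; simp [add_smul]
  simp only [h3, map_add, add_apply, h1] at h2
  linarith

variable {f : V → ℝ} {D : (EuclideanSpace ℝ (Fin n) →L[ℝ] U) →L[ℝ] V}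
  {φ : EuclideanSpace ℝ (Fin n) → U}

/-- The integrand is the divergence of a compactly supported field: the extra terms pair the
antisymmetric second derivative of `f` with the symmetric Hessian of `φ`. -/
theorem integral_fderiv_eq_zero (h : IsFlatOnCone f D) (hf : ContDiff ℝ (⊤ : ℕ∞) f)
    (hφ : ContDiff ℝ (⊤ : ℕ∞) φ) (hc : HasCompactSupport φ) (ξ : V) (t : ℝ) :
    ∫ x, fderiv ℝ f (ξ + t • D (fderiv ℝ φ x)) (D (fderiv ℝ φ x)) = 0 := by
  let e : Fin n → EuclideanSpace ℝ (Fin n) := fun i => EuclideanSpace.single i 1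
  let b : Fin n → U → V := fun i u =>
    D ((EuclideanSpace.proj i : EuclideanSpace ℝ (Fin n) →L[ℝ] ℝ).smulRight u)
  let bL : Fin n → U →L[ℝ] V := fun i =>
    D ∘L ContinuousLinearMap.smulRightL ℝ (EuclideanSpace ℝ (Fin n)) U (EuclideanSpace.proj i)
  have hbL : ∀ i u, bL i u = b i u := fun i u => rfl
  have hD : ∀ G : EuclideanSpace ℝ (Fin n) →L[ℝ] U, D G = ∑ j, b j (G (e j)) := by
    intro G
    conv_lhs => rw [clm_eq_sum_smulRight G, map_sum]
  let z : EuclideanSpace ℝ (Fin n) → V := fun x => D (fderiv ℝ φ x)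
  have hdφ : ContDiff ℝ (⊤ : ℕ∞) (fderiv ℝ φ) := hφ.fderiv_right (by simp)
  have hdf : ContDiff ℝ (⊤ : ℕ∞) (fderiv ℝ f) := hf.fderiv_right (by simp)
  have hz : ContDiff ℝ (⊤ : ℕ∞) z := D.contDiff.comp hdφ
  -- The field is obtained by replacing `∂ᵢφ` with `φ` in the `i`-th term of `D (∇φ) = ∑ bᵢ(∂ᵢφ)`.
  let Y : Fin n → EuclideanSpace ℝ (Fin n) → ℝ := fun i x =>
    fderiv ℝ f (ξ + t • z x) (bL i (φ x))
  have hY : ∀ i, ContDiff ℝ (⊤ : ℕ∞) (Y i) := fun i =>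
    (hdf.comp (contDiff_const.add (contDiff_const.smul hz))).clm_apply ((bL i).contDiff.comp hφ)
  have hYc : ∀ i, HasCompactSupport (Y i) := by
    intro i
    refine hc.mono fun x hx => ?_
    contrapose! hx
    have hx0 : φ x = 0 := by simpa using hx
    simp [Y, hx0]
  have hY' : ∀ i x, fderiv ℝ (Y i) x (e i) =
      (∑ j, t * fderiv ℝ (fderiv ℝ f) (ξ + t • z x) (b j (fderiv ℝ (fderiv ℝ φ) x (e i) (e j)))
        (b i (φ x))) + fderiv ℝ f (ξ + t • z x) (b i (fderiv ℝ φ x (e i))) := by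
    intro i x
    have h1 : HasFDerivAt (fun x => ξ + t • z x) (t • (D ∘L fderiv ℝ (fderiv ℝ φ) x)) x := by
      refine ((D.hasFDerivAt.comp x
        ((hdφ.differentiable (by simp)).differentiableAt.hasFDerivAt)).const_smul t).const_add ξ
    have h2 : HasFDerivAt (fun x => fderiv ℝ f (ξ + t • z x))
        (fderiv ℝ (fderiv ℝ f) (ξ + t • z x) ∘L (t • (D ∘L fderiv ℝ (fderiv ℝ φ) x))) x :=
      ((hdf.differentiable (by simp)).differentiableAt.hasFDerivAt (x := ξ + t • z x)).comp x h1
    have h3 : HasFDerivAt (fun x => bL i (φ x)) (bL i ∘L fderiv ℝ φ x) x :=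
      (bL i).hasFDerivAt.comp x (hφ.differentiable (by simp)).differentiableAt.hasFDerivAt
    rw [(h2.clm_apply h3).fderiv]
    simp only [add_apply, ContinuousLinearMap.comp_apply,
      ContinuousLinearMap.flip_apply, smul_apply, hD, map_smul, map_sum,
      _root_.sum_apply, smul_eq_mul, hbL, Finset.mul_sum]
    rw [add_comm]
  have hsum : ∀ x, ∑ i, fderiv ℝ (Y i) x (e i) = fderiv ℝ f (ξ + t • z x) (z x) := by
    intro x
    simp only [hY', Finset.sum_add_distrib]
    have h1 : ∀ i j, fderiv ℝ (fderiv ℝ φ) x (e i) (e j) = fderiv ℝ (fderiv ℝ φ) x (e j) (e i) :=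
      fun i j => ((hφ.of_le two_le_top).contDiffAt.isSymmSndFDerivAt (by simp)).eq _ _
    have h2 : ∑ i, ∑ j, t * fderiv ℝ (fderiv ℝ f) (ξ + t • z x)
        (b j (fderiv ℝ (fderiv ℝ φ) x (e i) (e j))) (b i (φ x)) = 0 := by
      have h3 : ∑ i, ∑ j, t * fderiv ℝ (fderiv ℝ f) (ξ + t • z x)
          (b j (fderiv ℝ (fderiv ℝ φ) x (e i) (e j))) (b i (φ x)) =
          -∑ i, ∑ j, t * fderiv ℝ (fderiv ℝ f) (ξ + t • z x)
          (b j (fderiv ℝ (fderiv ℝ φ) x (e i) (e j))) (b i (φ x)) := by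
        conv_lhs => rw [Finset.sum_comm]
        simp only [← Finset.sum_neg_distrib]
        refine Finset.sum_congr rfl fun i _ => Finset.sum_congr rfl fun j _ => ?_
        have h4 := h.polarized (hf.of_le two_le_top) (ξ + t • z x)
          (EuclideanSpace.proj i) (EuclideanSpace.proj j)
          (fderiv ℝ (fderiv ℝ φ) x (e i) (e j)) (φ x)
        rw [h1 j i]
        linear_combination t * h4
      linarith
    rw [h2, zero_add, ← map_sum, ← hD]
  have hint : ∀ i ∈ Finset.univ, Integrable fun x => fderiv ℝ (Y i) x (e i) := fun i _ =>
    (((hY i).continuous_fderiv (by simp)).clm_apply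
      continuous_const).integrable_of_hasCompactSupport ((hYc i).fderiv_apply ℝ (e i))
  calc ∫ x, fderiv ℝ f (ξ + t • z x) (z x) = ∫ x, ∑ i, fderiv ℝ (Y i) x (e i) := by
        simp only [hsum]
    _ = 0 := by
        rw [integral_finsetSum _ hint]
        exact Finset.sum_eq_zero fun i _ =>
          integral_fderiv_apply_eq_zero ((hY i).of_le (by exact_mod_cast le_top)) (hYc i) _

/-- Write the difference as the integral of its derivative along `t ∈ [0, 1]` and exchange the
integrals over a compact set; each inner integral is zero. -/
theorem integral_sub_eq_zero (h : IsFlatOnCone f D) (hf : ContDiff ℝ (⊤ : ℕ∞) f)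
    (hφ : ContDiff ℝ (⊤ : ℕ∞) φ) (hc : HasCompactSupport φ) (ξ : V) :
    ∫ x, (f (ξ + D (fderiv ℝ φ x)) - f ξ) = 0 := by
  let z : EuclideanSpace ℝ (Fin n) → V := fun x => D (fderiv ℝ φ x)
  have hdφ : Continuous (fderiv ℝ φ) := hφ.continuous_fderiv (by simp)
  have hz : Continuous z := D.continuous.comp hdφ
  have hdf : Continuous (fderiv ℝ f) := hf.continuous_fderiv (by simp)
  have hz0 : ∀ x ∉ tsupport φ, z x = 0 := by
    intro x hx
    have : fderiv ℝ φ x = 0 := by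
      by_contra h0
      exact hx (support_fderiv_subset ℝ h0)
    simp [z, this]
  have h1 : ∀ x, f (ξ + z x) - f ξ = ∫ t in (0 : ℝ)..1, fderiv ℝ f (ξ + t • z x) (z x) := by
    intro x
    rw [intervalIntegral.integral_eq_sub_of_hasDerivAt (f := fun t : ℝ => f (ξ + t • z x))]
    · simp
    · intro t _
      have h2 : HasDerivAt (fun t : ℝ => ξ + t • z x) (z x) t := by
        simpa using ((hasDerivAt_id t).smul_const (z x)).const_add ξ
      exact ((hf.differentiable (by simp)).differentiableAt.hasFDerivAt
        (x := ξ + t • z x)).comp_hasDerivAt t h2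
    · exact Continuous.intervalIntegrable
        ((hdf.comp (by fun_prop)).clm_apply continuous_const) _ _
  have hcont : Continuous fun p : EuclideanSpace ℝ (Fin n) × ℝ =>
      fderiv ℝ f (ξ + p.2 • z p.1) (z p.1) :=
    (hdf.comp (by fun_prop)).clm_apply (by fun_prop)
  calc ∫ x, (f (ξ + z x) - f ξ)
      = ∫ x in tsupport φ, (f (ξ + z x) - f ξ) := by
        rw [setIntegral_eq_integral_of_forall_compl_eq_zero]
        intro x hx
        simp [hz0 x hx]
    _ = ∫ x in tsupport φ, ∫ t in Set.Ioc (0 : ℝ) 1, fderiv ℝ f (ξ + t • z x) (z x) := by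
        simp only [h1, intervalIntegral.integral_of_le zero_le_one]
    _ = ∫ t in Set.Ioc (0 : ℝ) 1, ∫ x in tsupport φ, fderiv ℝ f (ξ + t • z x) (z x) := by
        refine integral_integral_swap ?_
        rw [Measure.prod_restrict]
        refine IntegrableOn.mono_set (t := tsupport φ ×ˢ Set.Icc (0 : ℝ) 1) ?_
          (Set.prod_mono le_rfl Set.Ioc_subset_Icc_self)
        exact hcont.continuousOn.integrableOn_compact (hc.isCompact.prod isCompact_Icc)
    _ = ∫ t in Set.Ioc (0 : ℝ) 1, (0 : ℝ) := by
        congr 1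
        funext t
        rw [setIntegral_eq_integral_of_forall_compl_eq_zero]
        · exact integral_fderiv_eq_zero h hf hφ hc ξ t
        · intro x hx
          simp [hz0 x hx]
    _ = 0 := by simp

end NullLagrangian

end ExtForms

/-! ### Mollification and weak gradients -/

namespace ExtForms
open scoped Convolution

section Mollify

variable {n : ℕ} {F : Type*} [NormedAddCommGroup F] [NormedSpace ℝ F]

/-- The mollification of `u` by the normed bump function `η`. -/
noncomputable def mollify (η : ContDiffBump (0 : EuclideanSpace ℝ (Fin n)))
    (u : EuclideanSpace ℝ (Fin n) → F) : EuclideanSpace ℝ (Fin n) → F :=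
  η.normed volume ⋆[ContinuousLinearMap.lsmul ℝ ℝ, volume] u

theorem mollify_apply (η : ContDiffBump (0 : EuclideanSpace ℝ (Fin n)))
    (u : EuclideanSpace ℝ (Fin n) → F) (x : EuclideanSpace ℝ (Fin n)) :
    mollify η u x = ∫ t, η.normed volume t • u (x - t) := rfl

theorem contDiff_mollify (η : ContDiffBump (0 : EuclideanSpace ℝ (Fin n)))
    {u : EuclideanSpace ℝ (Fin n) → F} (hu : LocallyIntegrable u) :
    ContDiff ℝ (⊤ : ℕ∞) (mollify η u) :=
  η.hasCompactSupport_normed.contDiff_convolution_left _ η.contDiff_normed hu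

theorem mollify_eq_zero (η : ContDiffBump (0 : EuclideanSpace ℝ (Fin n)))
    {u : EuclideanSpace ℝ (Fin n) → F} {r : ℝ} (hu : ∀ x, r < ‖x‖ → u x = 0)
    {x : EuclideanSpace ℝ (Fin n)} (hx : r + η.rOut < ‖x‖) : mollify η u x = 0 := by
  rw [mollify_apply]
  refine integral_eq_zero_of_ae (Eventually.of_forall fun t => ?_)
  by_cases ht : ‖t‖ < η.rOut
  · have h1 : r < ‖x - t‖ := by
      have := norm_sub_norm_le x t
      linarith
    simp [hu _ h1]
  · have h1 : η.normed volume t = 0 := by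
      rw [← Function.notMem_support, η.support_normed_eq]
      simpa using ht
    simp [h1]

theorem hasCompactSupport_mollify (η : ContDiffBump (0 : EuclideanSpace ℝ (Fin n)))
    {u : EuclideanSpace ℝ (Fin n) → F} {r : ℝ} (hu : ∀ x, r < ‖x‖ → u x = 0) :
    HasCompactSupport (mollify η u) := by
  refine HasCompactSupport.of_support_subset_isCompact
    (isCompact_closedBall (0 : EuclideanSpace ℝ (Fin n)) (r + η.rOut)) fun x hx => ?_
  by_contra h
  exact hx (mollify_eq_zero η hu (by simpa using h))

theorem norm_mollify_le (η : ContDiffBump (0 : EuclideanSpace ℝ (Fin n)))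
    {u : EuclideanSpace ℝ (Fin n) → F} {C : ℝ} (hu : ∀ᵐ x, ‖u x‖ ≤ C)
    (x : EuclideanSpace ℝ (Fin n)) : ‖mollify η u x‖ ≤ C := by
  have h1 : ∀ᵐ t, ‖u (x - t)‖ ≤ C :=
    (quasiMeasurePreserving_sub_left (volume : Measure (EuclideanSpace ℝ (Fin n))) x).ae hu
  have h2 : ∫ t, η.normed volume t * C = C := by
    rw [integral_mul_const, η.integral_normed, one_mul]
  rw [mollify_apply, ← h2]
  refine norm_integral_le_of_norm_le ((η.integrable_normed (μ := volume)).mul_const C) ?_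
  filter_upwards [h1] with t ht
  rw [norm_smul, Real.norm_of_nonneg (η.nonneg_normed (μ := volume) t)]
  exact mul_le_mul_of_nonneg_left ht (η.nonneg_normed (μ := volume) t)

/-- The derivative falls on the kernel, and `y ↦ η(x - y)` is an admissible test function for the
weak gradient; the two minus signs cancel. -/
theorem fderiv_mollify [CompleteSpace F] (η : ContDiffBump (0 : EuclideanSpace ℝ (Fin n)))
    {u : EuclideanSpace ℝ (Fin n) → F}
    {G : EuclideanSpace ℝ (Fin n) → EuclideanSpace ℝ (Fin n) →L[ℝ] F}
    (hu : LocallyIntegrable u) (hG : LocallyIntegrable G)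
    (h : ∀ θ : EuclideanSpace ℝ (Fin n) → ℝ, ContDiff ℝ (⊤ : ℕ∞) θ → HasCompactSupport θ →
      ∀ v, ∫ x, fderiv ℝ θ x v • u x = -∫ x, θ x • G x v) (x : EuclideanSpace ℝ (Fin n)) :
    fderiv ℝ (mollify η u) x = mollify η G x := by
  have hη : ContDiff ℝ (⊤ : ℕ∞) (η.normed volume) := η.contDiff_normed
  have hd := (η.hasCompactSupport_normed (μ := volume)).hasFDerivAt_convolution_left
    (ContinuousLinearMap.lsmul ℝ ℝ) (μ := volume) (η.contDiff_normed (n := 1)) hu x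
  rw [mollify, hd.fderiv]
  ext v
  let θ : EuclideanSpace ℝ (Fin n) → ℝ := fun y => η.normed volume (x - y)
  have hθ : ContDiff ℝ (⊤ : ℕ∞) θ := hη.comp (contDiff_const.sub contDiff_id)
  have hθc : HasCompactSupport θ :=
    η.hasCompactSupport_normed.comp_homeomorph (Homeomorph.subLeft x)
  have hθ' : ∀ y, fderiv ℝ θ y v = -fderiv ℝ (η.normed volume) (x - y) v := by
    intro y
    have h1 : HasFDerivAt (fun y : EuclideanSpace ℝ (Fin n) => x - y)
        (-ContinuousLinearMap.id ℝ _) y := (hasFDerivAt_id y).const_sub x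
    have h2 := ((hη.differentiable (by simp)).differentiableAt.hasFDerivAt (x := x - y)).comp y h1
    rw [show fderiv ℝ θ y = _ from h2.fderiv]
    simp
  have hi1 := (η.hasCompactSupport_normed.fderiv ℝ).convolutionExists_left
    ((ContinuousLinearMap.lsmul ℝ ℝ : ℝ →L[ℝ] F →L[ℝ] F).precompL (EuclideanSpace ℝ (Fin n)))
    (hη.continuous_fderiv (by simp)) hu x (μ := volume)
  have hi2 := η.hasCompactSupport_normed.convolutionExists_left
    (ContinuousLinearMap.lsmul ℝ ℝ : ℝ →L[ℝ] (EuclideanSpace ℝ (Fin n) →L[ℝ] F) →L[ℝ] _)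
    hη.continuous hG x (μ := volume)
  rw [mollify_apply, convolution_def, ContinuousLinearMap.integral_apply hi1]
  have e1 := integral_sub_left_eq_self (μ := volume)
    (fun t => (fderiv ℝ (η.normed volume) t v) • u (x - t)) x
  have e2 := integral_sub_left_eq_self (μ := volume)
    (fun t => η.normed volume t • G (x - t) v) x
  simp only [sub_sub_cancel] at e1 e2
  have h3 := h θ hθ hθc v
  simp only [hθ', neg_smul, integral_neg, neg_inj] at h3
  exact (e1.symm.trans (h3.trans e2)).trans (ContinuousLinearMap.integral_apply hi2 v).symm

end Mollify

section Approximation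

theorem tendsto_integral_clm_apply {α X Y : Type*} [MeasurableSpace α] {μ : Measure α}
    [NormedAddCommGroup X] [NormedSpace ℝ X] [NormedAddCommGroup Y] [NormedSpace ℝ Y]
    {A : α → X →L[ℝ] Y} {C : ℝ} (hA : AEStronglyMeasurable A μ) (hC : ∀ x, ‖A x‖ ≤ C)
    {h : ℕ → α → X} {g : α → X} (hh : ∀ j, Integrable (h j) μ) (hg : Integrable g μ)
    (hlim : Tendsto (fun j => eLpNorm (h j - g) 1 μ) atTop (𝓝 0)) :
    Tendsto (fun j => ∫ x, A x (h j x) ∂μ) atTop (𝓝 (∫ x, A x (g x) ∂μ)) := by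
  have hint : ∀ {g : α → X}, Integrable g μ → Integrable (fun x => A x (g x)) μ := by
    intro g hg
    refine Integrable.mono' (hg.norm.const_mul C) ?_ (Eventually.of_forall fun x => ?_)
    · exact (ContinuousLinearMap.id ℝ (X →L[ℝ] Y)).aestronglyMeasurable_comp₂ hA hg.aestronglyMeasurable
    · exact (A x).le_of_opNorm_le (hC x) _
  refine tendsto_integral_of_L1' _ (hint hg).aestronglyMeasurable (Eventually.of_forall fun j => hint (hh j)) ?_
  have hb : ∀ j, eLpNorm ((fun x => A x (h j x)) - fun x => A x (g x)) 1 μ ≤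
      ENNReal.ofReal C * eLpNorm (h j - g) 1 μ := by
    intro j
    refine eLpNorm_le_mul_eLpNorm_of_ae_le_mul (Eventually.of_forall fun x => ?_) 1
    simp only [Pi.sub_apply, ← map_sub]
    exact (A x).le_of_opNorm_le (hC x) _
  refine tendsto_of_tendsto_of_tendsto_of_le_of_le tendsto_const_nhds ?_ (fun _ => zero_le) hb
  simpa using ENNReal.Tendsto.const_mul hlim (Or.inr ENNReal.ofReal_ne_top)

/-- `W₀^{1,∞}(Ω)` for functions with values in a normed space: `ω` and `G` are bounded, and
approximated in `W^{1,1}(Ω)` by test functions and their gradients. -/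
structure IsW01 {n : ℕ} {F : Type*} [NormedAddCommGroup F] [NormedSpace ℝ F]
    (Ω : Set (EuclideanSpace ℝ (Fin n))) (ω : EuclideanSpace ℝ (Fin n) → F)
    (G : EuclideanSpace ℝ (Fin n) → EuclideanSpace ℝ (Fin n) →L[ℝ] F) : Prop where
  memLp : MemLp ω ⊤ (volume.restrict Ω)
  memLp_gradient : MemLp G ⊤ (volume.restrict Ω)
  exists_approx : ∃ φ : ℕ → EuclideanSpace ℝ (Fin n) → F,
    (∀ j, ContDiff ℝ (⊤ : ℕ∞) (φ j) ∧ HasCompactSupport (φ j) ∧ tsupport (φ j) ⊆ Ω) ∧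
    Tendsto (fun j => eLpNorm (φ j - ω) 1 (volume.restrict Ω)) atTop (𝓝 0) ∧
    Tendsto (fun j => eLpNorm (fderiv ℝ (φ j) - G) 1 (volume.restrict Ω)) atTop (𝓝 0)

theorem IsW01Infty.isW01 {n r : ℕ} {Ω : Set (EuclideanSpace ℝ (Fin n))}
    {ω : EuclideanSpace ℝ (Fin n) → Form n r}
    {G : EuclideanSpace ℝ (Fin n) → EuclideanSpace ℝ (Fin n) →L[ℝ] Form n r}
    (h : IsW01Infty Ω ω G) : IsW01 Ω ω G :=
  ⟨h.memLp, h.memLp_gradient, h.exists_approx⟩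

variable {n : ℕ} {F : Type*} [NormedAddCommGroup F] [NormedSpace ℝ F]
  {Ω : Set (EuclideanSpace ℝ (Fin n))} {ω : EuclideanSpace ℝ (Fin n) → F}
  {G : EuclideanSpace ℝ (Fin n) → EuclideanSpace ℝ (Fin n) →L[ℝ] F}

theorem IsW01.integrableOn (h : IsW01 Ω ω G) (hΩ : Bornology.IsBounded Ω) :
    IntegrableOn ω Ω := by
  have : IsFiniteMeasure (volume.restrict Ω) := ⟨by simpa using hΩ.measure_lt_top⟩
  exact h.memLp.integrable le_top

theorem IsW01.integrableOn_gradient (h : IsW01 Ω ω G) (hΩ : Bornology.IsBounded Ω) :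
    IntegrableOn G Ω := by
  have : IsFiniteMeasure (volume.restrict Ω) := ⟨by simpa using hΩ.measure_lt_top⟩
  exact h.memLp_gradient.integrable le_top

/-- Zero boundary values enter here. For the approximating `φ j`, supported in `Ω`, integration by
parts holds against any `θ`, even one not vanishing near the boundary; `L¹` convergence preserves
it. So the extension by zero has the extended gradient on all of `ℝⁿ`. -/
theorem IsW01.integral_indicator (h : IsW01 Ω ω G) (hΩo : IsOpen Ω)
    (hΩ : Bornology.IsBounded Ω) {θ : EuclideanSpace ℝ (Fin n) → ℝ} (hθ : ContDiff ℝ (⊤ : ℕ∞) θ)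
    (hθc : HasCompactSupport θ) (v : EuclideanSpace ℝ (Fin n)) :
    ∫ x, fderiv ℝ θ x v • Ω.indicator ω x = -∫ x, θ x • Ω.indicator G x v := by
  have hdθ : Continuous fun x => fderiv ℝ θ x v :=
    (hθ.continuous_fderiv (by simp)).clm_apply continuous_const
  have hdθc : HasCompactSupport fun x => fderiv ℝ θ x v := hθc.fderiv_apply ℝ v
  have e1 : ∫ x, fderiv ℝ θ x v • Ω.indicator ω x = ∫ x in Ω, fderiv ℝ θ x v • ω x := by
    rw [← MeasureTheory.integral_indicator hΩo.measurableSet]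
    congr 1
    funext x
    by_cases hx : x ∈ Ω <;> simp [hx]
  have e2 : ∫ x, θ x • Ω.indicator G x v = ∫ x in Ω, θ x • G x v := by
    rw [← MeasureTheory.integral_indicator hΩo.measurableSet]
    congr 1
    funext x
    by_cases hx : x ∈ Ω <;> simp [hx]
  rw [e1, e2]
  obtain ⟨φ, hφ, hl1, hl2⟩ := h.exists_approx
  have hφ' : ∀ j, Continuous (fderiv ℝ (φ j)) := fun j => (hφ j).1.continuous_fderiv (by simp)
  obtain ⟨C1, hC1⟩ := hdθ.bounded_above_of_compact_support hdθc
  obtain ⟨C2, hC2⟩ := hθ.continuous.bounded_above_of_compact_support hθc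
  have t1 := tendsto_integral_clm_apply (μ := volume.restrict Ω)
    (A := fun x => fderiv ℝ θ x v • ContinuousLinearMap.id ℝ (F)) (C := C1)
    (hdθ.smul continuous_const).aestronglyMeasurable
    (fun x => by
      rw [norm_smul]
      exact (mul_le_of_le_one_right (norm_nonneg _) ContinuousLinearMap.norm_id_le).trans (hC1 x))
    (fun j => ((hφ j).1.continuous.integrable_of_hasCompactSupport (hφ j).2.1).integrableOn)
    (h.integrableOn hΩ) hl1
  have : SecondCountableTopologyEither (EuclideanSpace ℝ (Fin n))
    ((EuclideanSpace ℝ (Fin n) →L[ℝ] F) →L[ℝ] F) := ⟨Or.inl inferInstance⟩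
  have t2 := tendsto_integral_clm_apply (μ := volume.restrict Ω)
    (A := fun x => θ x • ContinuousLinearMap.apply ℝ (F) v) (C := C2 * ‖v‖)
    (hθ.continuous.smul continuous_const).aestronglyMeasurable
    (fun x => by
      rw [norm_smul]
      refine mul_le_mul (hC2 x) ?_ (norm_nonneg _) ((norm_nonneg _).trans (hC2 x))
      refine ContinuousLinearMap.opNorm_le_bound _ (norm_nonneg _) fun L => ?_
      rw [mul_comm]
      exact L.le_opNorm v)
    (fun j => ((hφ' j).integrable_of_hasCompactSupport ((hφ j).2.1.fderiv ℝ)).integrableOn)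
    (h.integrableOn_gradient hΩ) hl2
  refine tendsto_nhds_unique t1 ((t2.neg).congr fun j => ?_)
  have hj0 : ∀ x ∉ Ω, φ j x = 0 := fun x hx =>
    image_eq_zero_of_notMem_tsupport fun hx' => hx ((hφ j).2.2 hx')
  have hj0' : ∀ x ∉ Ω, fderiv ℝ (φ j) x = 0 := fun x hx => by
    by_contra h0
    exact hx ((hφ j).2.2 (support_fderiv_subset ℝ h0))
  rw [setIntegral_eq_integral_of_forall_compl_eq_zero fun x hx => by simp [hj0' x hx],
    setIntegral_eq_integral_of_forall_compl_eq_zero fun x hx => by simp [hj0 x hx]]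
  have hp := integral_smul_fderiv_eq_neg_fderiv_smul_of_integrable (μ := volume) (𝕜 := ℝ)
    (f := θ) (g := φ j) (v := v)
    ((hdθ.smul (hφ j).1.continuous).integrable_of_hasCompactSupport (hdθc.smul_right))
    ((hθ.continuous.smul ((hφ' j).clm_apply continuous_const)).integrable_of_hasCompactSupport
      hθc.smul_right)
    ((hθ.continuous.smul (hφ j).1.continuous).integrable_of_hasCompactSupport hθc.smul_right)
    (fun _ _ => (hθ.differentiable (by simp)).differentiableAt)
    (fun _ _ => ((hφ j).1.differentiable (by simp)).differentiableAt)
  simp only [smul_apply, ContinuousLinearMap.apply_apply, ContinuousLinearMap.id_apply]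
  rw [hp, neg_neg]

end Approximation

end ExtForms

/-! ### Smooth approximation and (iii) ⇒ (ii) -/

namespace ExtForms

section Mollification

variable {n : ℕ} {F : Type*} [NormedAddCommGroup F] [NormedSpace ℝ F]
  {Ω : Set (EuclideanSpace ℝ (Fin n))} {ω : EuclideanSpace ℝ (Fin n) → F}
  {G : EuclideanSpace ℝ (Fin n) → EuclideanSpace ℝ (Fin n) →L[ℝ] F}

/-- A bump function with outer radius `2 / (j + 1)`. -/
noncomputable def bump (n j : ℕ) : ContDiffBump (0 : EuclideanSpace ℝ (Fin n)) where
  rIn := 1 / (j + 1)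
  rOut := 2 / (j + 1)
  rIn_pos := by positivity
  rIn_lt_rOut := by gcongr; norm_num

theorem bump_rOut_le (n j : ℕ) : (bump n j).rOut ≤ 2 := by
  change (2 : ℝ) / (j + 1) ≤ 2
  rw [div_le_iff₀ (by positivity)]
  have : (0 : ℝ) ≤ j := j.cast_nonneg
  linarith

theorem tendsto_bump_rOut (n : ℕ) : Tendsto (fun j => (bump n j).rOut) atTop (𝓝 0) := by
  have h := (tendsto_one_div_add_atTop_nhds_zero_nat (𝕜 := ℝ)).const_mul 2
  simp only [mul_zero, mul_one_div] at h
  exact h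

theorem ae_tendsto_mollify [CompleteSpace F] {u : EuclideanSpace ℝ (Fin n) → F}
    (hu : LocallyIntegrable u) :
    ∀ᵐ x, Tendsto (fun j => mollify (bump n j) u x) atTop (𝓝 (u x)) := by
  refine ContDiffBump.ae_convolution_tendsto_right_of_locallyIntegrable (K := 2)
    (tendsto_bump_rOut n) (Eventually.of_forall fun j => ?_) hu
  change (2 : ℝ) / (j + 1) ≤ 2 * (1 / (j + 1))
  rw [mul_one_div]

theorem locallyIntegrable_indicator {Y : Type*} [NormedAddCommGroup Y]
    {g : EuclideanSpace ℝ (Fin n) → Y} (hΩo : IsOpen Ω) (hg : IntegrableOn g Ω) :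
    LocallyIntegrable (Ω.indicator g) :=
  (hg.integrable_indicator hΩo.measurableSet).locallyIntegrable

theorem IsW01.locallyIntegrable (h : IsW01 Ω ω G) (hΩo : IsOpen Ω) (hΩ : Bornology.IsBounded Ω) :
    LocallyIntegrable (Ω.indicator ω) :=
  locallyIntegrable_indicator hΩo (h.integrableOn hΩ)

theorem IsW01.locallyIntegrable_gradient (h : IsW01 Ω ω G) (hΩo : IsOpen Ω)
    (hΩ : Bornology.IsBounded Ω) : LocallyIntegrable (Ω.indicator G) :=
  locallyIntegrable_indicator hΩo (h.integrableOn_gradient hΩ)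

theorem IsW01.exists_bound (h : IsW01 Ω ω G) (hΩo : IsOpen Ω) :
    ∃ C, ∀ᵐ x, ‖Ω.indicator G x‖ ≤ C := by
  have h1 := h.memLp_gradient.2
  rw [eLpNorm_exponent_top] at h1
  refine ⟨(eLpNormEssSup G (volume.restrict Ω)).toReal, ?_⟩
  have h2 := (ae_restrict_iff' hΩo.measurableSet).mp
    (ae_le_eLpNormEssSup (f := G) (μ := volume.restrict Ω))
  filter_upwards [h2] with x hx
  by_cases hxΩ : x ∈ Ω
  · rw [Set.indicator_of_mem hxΩ, ← toReal_enorm]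
    exact ENNReal.toReal_mono h1.ne (hx hxΩ)
  · rw [Set.indicator_of_notMem hxΩ, norm_zero]
    exact ENNReal.toReal_nonneg

/-- A function in `W₀^{1,∞}(Ω)`, extended by zero, is the limit of test functions which are bounded
in `W^{1,∞}` and supported in a fixed ball. -/
theorem IsW01.exists_smooth_approx [CompleteSpace F] (h : IsW01 Ω ω G) (hΩo : IsOpen Ω)
    (hΩ : Bornology.IsBounded Ω) : ∃ (r C : ℝ) (u : ℕ → EuclideanSpace ℝ (Fin n) → F),
      (∀ j, ContDiff ℝ (⊤ : ℕ∞) (u j)) ∧ (∀ j, HasCompactSupport (u j)) ∧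
      (∀ j x, r < ‖x‖ → fderiv ℝ (u j) x = 0) ∧ (∀ j x, ‖fderiv ℝ (u j) x‖ ≤ C) ∧
      (∀ x, r < ‖x‖ → x ∉ Ω) ∧
      ∀ᵐ x, Tendsto (fun j => fderiv ℝ (u j) x) atTop (𝓝 (Ω.indicator G x)) := by
  obtain ⟨r, hr⟩ := hΩ.exists_norm_le
  obtain ⟨C, hC⟩ := h.exists_bound hΩo
  have hr' : ∀ x, r < ‖x‖ → x ∉ Ω := fun x hx hxΩ => absurd (hr x hxΩ) (not_le.mpr hx)
  have h1 : ∀ j x, fderiv ℝ (mollify (bump n j) (Ω.indicator ω)) x =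
      mollify (bump n j) (Ω.indicator G) x := fun j x =>
    fderiv_mollify (bump n j) (h.locallyIntegrable hΩo hΩ) (h.locallyIntegrable_gradient hΩo hΩ)
      (fun θ hθ hθc v => h.integral_indicator hΩo hΩ hθ hθc v) x
  -- Mollification enlarges supports by at most `2`. The approximants may leave `Ω`, but they stay
  -- in one fixed ball.
  refine ⟨r + 2, C, fun j => mollify (bump n j) (Ω.indicator ω),
    fun j => contDiff_mollify _ (h.locallyIntegrable hΩo hΩ),
    fun j => hasCompactSupport_mollify _ (r := r)
      fun x hx => Set.indicator_of_notMem (hr' x hx) _,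
    fun j x hx => ?_, fun j x => ?_, fun x hx => hr' x (by linarith), ?_⟩
  · rw [h1]
    refine mollify_eq_zero _ (r := r) (fun x hx => Set.indicator_of_notMem (hr' x hx) _) ?_
    linarith [bump_rOut_le n j]
  · rw [h1]
    exact norm_mollify_le _ hC x
  · simp only [h1]
    exact ae_tendsto_mollify (h.locallyIntegrable_gradient hΩo hΩ)

end Mollification

theorem fderiv_fderiv_eq_zero_of_affine {V : Type*} [NormedAddCommGroup V] [NormedSpace ℝ V]
    {f : V → ℝ} (hf : ContDiff ℝ (⊤ : ℕ∞) f) {η v : V}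
    (h : ∃ g : ℝ →ᵃ[ℝ] ℝ, ∀ t : ℝ, f (η + t • v) = g t) : fderiv ℝ (fderiv ℝ f) η v v = 0 := by
  obtain ⟨g, hg⟩ := h
  have hdf : ContDiff ℝ (⊤ : ℕ∞) (fderiv ℝ f) := hf.fderiv_right (by simp)
  have hl : ∀ t : ℝ, HasDerivAt (fun t : ℝ => η + t • v) v t := fun t => by
    simpa using ((hasDerivAt_id t).smul_const v).const_add η
  have h1 : ∀ t : ℝ, HasDerivAt (fun t : ℝ => f (η + t • v)) (fderiv ℝ f (η + t • v) v) t :=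
    fun t => ((hf.differentiable (by simp)).differentiableAt.hasFDerivAt
      (x := η + t • v)).comp_hasDerivAt t (hl t)
  have h2 : ∀ t : ℝ, HasDerivAt (fun t : ℝ => f (η + t • v)) (g.linear 1) t := by
    intro t
    rw [funext hg]
    exact g.hasDerivAt
  have h3 : (fun t : ℝ => fderiv ℝ f (η + t • v) v) = fun _ => g.linear 1 :=
    funext fun t => (h1 t).unique (h2 t)
  have h4 : HasDerivAt (fun t : ℝ => fderiv ℝ f (η + t • v) v)
      (fderiv ℝ (fderiv ℝ f) η v v) 0 := by
    have h5 := ((hdf.differentiable (by simp)).differentiableAt.hasFDerivAt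
      (x := η + (0 : ℝ) • v)).comp_hasDerivAt 0 (hl 0)
    rw [zero_smul, add_zero] at h5
    simpa using h5.clm_apply (hasDerivAt_const 0 v)
  rw [h3] at h4
  exact h4.unique (hasDerivAt_const _ _)

section Quasiaffine

variable {n m : ℕ} {k : Fin m → ℕ} (hk : ∀ i, 1 ≤ k i)

theorem dOfGradient_add {n k : ℕ} (hk : 1 ≤ k)
    (g h : EuclideanSpace ℝ (Fin n) →L[ℝ] Form n (k - 1)) :
    dOfGradient hk (g + h) = dOfGradient hk g + dOfGradient hk h := by
  rw [dOfGradient, ContinuousAlternatingMap.alternatizeUncurryFin_add]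
  rfl

theorem dOfGradient_smul {n k : ℕ} (hk : 1 ≤ k) (c : ℝ)
    (g : EuclideanSpace ℝ (Fin n) →L[ℝ] Form n (k - 1)) :
    dOfGradient hk (c • g) = c • dOfGradient hk g := by
  rw [dOfGradient, ContinuousAlternatingMap.alternatizeUncurryFin_smul]
  rfl

theorem dOfGradient_zero {n k : ℕ} (hk : 1 ≤ k) :
    dOfGradient hk (0 : EuclideanSpace ℝ (Fin n) →L[ℝ] Form n (k - 1)) = 0 := by
  ext v
  rw [dOfGradient]
  change ContinuousAlternatingMap.alternatizeUncurryFin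
    (0 : EuclideanSpace ℝ (Fin n) →L[ℝ] Form n (k - 1)) _ = 0
  rw [ContinuousAlternatingMap.alternatizeUncurryFin_apply]
  exact Finset.sum_eq_zero fun i _ => smul_zero _

theorem continuous_dOfGradient {n k : ℕ} (hk : 1 ≤ k) :
    Continuous fun g : EuclideanSpace ℝ (Fin n) →L[ℝ] Form n (k - 1) => dOfGradient hk g :=
  LinearMap.continuous_of_finiteDimensional
    (IsLinearMap.mk' _ ⟨dOfGradient_add hk, dOfGradient_smul hk⟩)

/-- The exterior derivatives of the components, as a linear function of the gradient of
`(ω₁, …, ωₘ)`. -/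
noncomputable def extDeriv' :
    (EuclideanSpace ℝ (Fin n) →L[ℝ] ((i : Fin m) → Form n (k i - 1))) →L[ℝ]
      ((i : Fin m) → Form n (k i)) :=
  LinearMap.toContinuousLinearMap
    { toFun := fun g i => dOfGradient (hk i) ((ContinuousLinearMap.proj i).comp g)
      map_add' := fun g h => funext fun i => by
        rw [ContinuousLinearMap.comp_add, dOfGradient_add]; rfl
      map_smul' := fun c g => funext fun i => by
        rw [ContinuousLinearMap.comp_smul, dOfGradient_smul]; rfl }

theorem extDeriv'_apply (g : EuclideanSpace ℝ (Fin n) →L[ℝ] ((i : Fin m) → Form n (k i - 1)))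
    (i : Fin m) : extDeriv' hk g i = dOfGradient (hk i) ((ContinuousLinearMap.proj i).comp g) := rfl

theorem extDeriv'_smulRight (p : EuclideanSpace ℝ (Fin n) →L[ℝ] ℝ)
    (β : (i : Fin m) → Form n (k i - 1)) : extDeriv' hk (p.smulRight β) =
      fun i => Form.cast (Nat.add_sub_of_le (hk i)) (wedge (covectorForm p) (β i)) := by
  funext i
  rw [extDeriv'_apply, ← dOfGradient_smulRight]
  rfl

theorem isFlatOnCone_of_oneAffine {f : ((i : Fin m) → Form n (k i)) → ℝ}
    (hf : ContDiff ℝ (⊤ : ℕ∞) f) (h : VectoriallyExtOneAffine k hk f) :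
    IsFlatOnCone f (extDeriv' (n := n) hk) := by
  intro η p β
  refine fderiv_fderiv_eq_zero_of_affine hf ?_
  obtain ⟨g, hg⟩ := h η (covectorForm p) β
  refine ⟨g, fun t => ?_⟩
  rw [← hg, extDeriv'_smulRight]
  rfl

end Quasiaffine

/-- Dominated convergence: the arguments of `f` stay in a closed ball around `ξ`, where `f - f ξ` is
bounded, and the integrands vanish outside a fixed ball. -/
theorem integrable_and_integral_eq_zero {n : ℕ} {U V : Type*} [NormedAddCommGroup U]
    [NormedSpace ℝ U] [NormedAddCommGroup V] [NormedSpace ℝ V] [FiniteDimensional ℝ V]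
    {f : V → ℝ} {D : (EuclideanSpace ℝ (Fin n) →L[ℝ] U) →L[ℝ] V} (h : IsFlatOnCone f D)
    (hf : ContDiff ℝ (⊤ : ℕ∞) f) {r C : ℝ} {u : ℕ → EuclideanSpace ℝ (Fin n) → U}
    (hu : ∀ j, ContDiff ℝ (⊤ : ℕ∞) (u j)) (huc : ∀ j, HasCompactSupport (u j))
    (hr : ∀ j x, r < ‖x‖ → fderiv ℝ (u j) x = 0) (hC : ∀ j x, ‖fderiv ℝ (u j) x‖ ≤ C)
    {z : EuclideanSpace ℝ (Fin n) → V}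
    (hlim : ∀ᵐ x, Tendsto (fun j => D (fderiv ℝ (u j) x)) atTop (𝓝 (z x))) (ξ : V) :
    Integrable (fun x => f (ξ + z x) - f ξ) ∧ ∫ x, (f (ξ + z x) - f ξ) = 0 := by
  have hC0 : 0 ≤ C := (norm_nonneg _).trans (hC 0 0)
  obtain ⟨M, hM⟩ := (isCompact_closedBall ξ (‖D‖ * C)).exists_bound_of_continuousOn
    (f := fun η => f η - f ξ) (hf.continuous.sub continuous_const).continuousOn
  have hbd : ∀ j x, ‖f (ξ + D (fderiv ℝ (u j) x)) - f ξ‖ ≤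
      (Metric.closedBall (0 : EuclideanSpace ℝ (Fin n)) r).indicator (fun _ => M) x := by
    intro j x
    by_cases hx : x ∈ Metric.closedBall (0 : EuclideanSpace ℝ (Fin n)) r
    · rw [Set.indicator_of_mem hx]
      refine hM _ ?_
      rw [mem_closedBall_iff_norm, add_sub_cancel_left]
      exact (D.le_opNorm _).trans (mul_le_mul_of_nonneg_left (hC j x) (norm_nonneg _))
    · rw [Set.indicator_of_notMem hx, hr j x (by simpa using hx)]
      simp
  have hbi : Integrable ((Metric.closedBall (0 : EuclideanSpace ℝ (Fin n)) r).indicator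
      fun _ => M) := by
    rw [integrable_indicator_iff measurableSet_closedBall]
    exact integrableOn_const (measure_closedBall_lt_top.ne)
  have hmeas : ∀ j, AEStronglyMeasurable (fun x => f (ξ + D (fderiv ℝ (u j) x)) - f ξ) volume := by
    intro j
    have hd : Continuous (fderiv ℝ (u j)) := (hu j).continuous_fderiv (by simp)
    exact ((hf.continuous.comp (continuous_const.add (D.continuous.comp hd))).sub
      continuous_const).aestronglyMeasurable
  have hl : ∀ᵐ x, Tendsto (fun j => f (ξ + D (fderiv ℝ (u j) x)) - f ξ) atTop
      (𝓝 (f (ξ + z x) - f ξ)) := by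
    filter_upwards [hlim] with x hx
    exact ((hf.continuous.tendsto _).comp (hx.const_add ξ)).sub_const _
  have ht := tendsto_integral_of_dominated_convergence _ hmeas hbi
    (fun j => Eventually.of_forall (hbd j)) hl
  simp only [integral_sub_eq_zero h hf (hu _) (huc _) ξ] at ht
  refine ⟨?_, (tendsto_nhds_unique ht tendsto_const_nhds)⟩
  refine hbi.mono' (aestronglyMeasurable_of_tendsto_ae atTop hmeas hl) ?_
  filter_upwards [hl] with x hx
  exact le_of_tendsto hx.norm (Eventually.of_forall fun j => hbd j x)

/-- The limit field `z` is extended by zero, so the integrand vanishes off `Ω` and the integral over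
`ℝⁿ` is the one over `Ω`. -/
theorem quasiaffine_of_contDiff {n m : ℕ} {k : Fin m → ℕ} (hk : ∀ i, 1 ≤ k i)
    {f : ((i : Fin m) → Form n (k i)) → ℝ} (hf : ContDiff ℝ (⊤ : ℕ∞) f)
    (h : VectoriallyExtOneAffine k hk f) : VectoriallyExtQuasiaffine k hk f := by
  refine ⟨?_, fun ξ => ?_, fun Ω hΩo hΩ hΩn ξ ω G hω => ?_⟩
  · borelize ((i : Fin m) → Form n (k i))
    exact hf.continuous.measurable
  · refine ⟨{η | |f η| < |f ξ| + 1}, ?_, |f ξ| + 1, fun η hη => le_of_lt hη⟩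
    exact (isOpen_lt hf.continuous.abs continuous_const).mem_nhds (by simp)
  · choose r C u hu huc hr hC hrΩ hlim using fun i => (hω i).isW01.exists_smooth_approx hΩo hΩ
    let U : ℕ → EuclideanSpace ℝ (Fin n) → (i : Fin m) → Form n (k i - 1) := fun j x i => u i j x
    have hU : ∀ j, ContDiff ℝ (⊤ : ℕ∞) (U j) := fun j => contDiff_pi.mpr fun i => hu i j
    have hUd : ∀ j x, fderiv ℝ (U j) x = ContinuousLinearMap.pi fun i => fderiv ℝ (u i j) x :=
      fun j x => fderiv_pi fun i => ((hu i j).differentiable (by simp)).differentiableAt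
    have hUc : ∀ j, HasCompactSupport (U j) := by
      intro j
      have hK : IsCompact (⋃ i, tsupport (u i j)) := isCompact_iUnion fun i => huc i j
      refine HasCompactSupport.of_support_subset_isCompact hK fun x hx => ?_
      obtain ⟨i, hi⟩ := Function.ne_iff.mp hx
      exact Set.mem_iUnion.mpr ⟨i, subset_tsupport _ hi⟩
    have hUr : ∀ j x, (∑ i, |r i|) < ‖x‖ → fderiv ℝ (U j) x = 0 := by
      intro j x hx
      rw [hUd]
      ext v i
      have h1 : r i < ‖x‖ := ((le_abs_self _).trans (Finset.single_le_sum (f := fun i => |r i|)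
        (fun _ _ => abs_nonneg _) (Finset.mem_univ i))).trans_lt hx
      simp [hr i j x h1]
    have hUC : ∀ j x, ‖fderiv ℝ (U j) x‖ ≤ ∑ i, |C i| := by
      intro j x
      rw [hUd]
      refine ContinuousLinearMap.opNorm_le_bound _ (Finset.sum_nonneg fun _ _ => abs_nonneg _)
        fun v => (pi_norm_le_iff_of_nonneg (by positivity)).mpr fun i => ?_
      refine (ContinuousLinearMap.le_of_opNorm_le _ ((hC i j x).trans ((le_abs_self _).trans
        (Finset.single_le_sum (f := fun i => |C i|)
        (fun _ _ => abs_nonneg _) (Finset.mem_univ i)))) v)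
    let z : EuclideanSpace ℝ (Fin n) → (i : Fin m) → Form n (k i) := fun x i =>
      dOfGradient (hk i) (Ω.indicator (G i) x)
    have hz : ∀ᵐ x, Tendsto (fun j => extDeriv' hk (fderiv ℝ (U j) x)) atTop (𝓝 (z x)) := by
      filter_upwards [ae_all_iff.mpr hlim] with x hx
      refine tendsto_pi_nhds.mpr fun i => ?_
      simp only [hUd]
      exact ((continuous_dOfGradient (hk i)).tendsto _).comp (hx i)
    obtain ⟨hi, h0⟩ := integrable_and_integral_eq_zero (isFlatOnCone_of_oneAffine hk hf h) hf hU
      hUc hUr hUC hz ξ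
    have hzΩ : ∀ x ∈ Ω, z x = fun i => dOfGradient (hk i) (G i x) := by
      intro x hx
      funext i
      simp [z, hx]
    have hz0 : ∀ x ∉ Ω, z x = 0 := by
      intro x hx
      funext i
      simp [z, hx, dOfGradient_zero]
    have h1 : ∫ x in Ω, (f (ξ + z x) - f ξ) = 0 := by
      rw [setIntegral_eq_integral_of_forall_compl_eq_zero, h0]
      intro x hx
      simp [hz0 x hx]
    have hfin : volume Ω ≠ ⊤ := hΩ.measure_lt_top.ne
    have hpos : volume Ω ≠ 0 := (hΩo.measure_pos volume hΩn).ne'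
    have hci : IntegrableOn (fun _ => f ξ) Ω volume := integrableOn_const hfin
    have h2 : ∫ x in Ω, f (fun i => ξ i + dOfGradient (hk i) (G i x)) = ∫ x in Ω, f ξ := by
      have h3 : ∫ x in Ω, f (fun i => ξ i + dOfGradient (hk i) (G i x)) =
          ∫ x in Ω, ((f (ξ + z x) - f ξ) + f ξ) := by
        refine setIntegral_congr_fun hΩo.measurableSet fun x hx => ?_
        simp only [sub_add_cancel, hzΩ x hx]
        rfl
      rw [h3, integral_add hi.integrableOn hci, h1, zero_add]
    rw [average_eq, h2, ← average_eq]
    exact setAverage_const hpos hfin _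

end ExtForms

/-! ### Compactly supported Lipschitz functions as test fields -/

namespace ExtForms

theorem tendsto_eLpNorm_one_of_bounded {α Y : Type*} [MeasurableSpace α] {μ : Measure α}
    [IsFiniteMeasure μ] [NormedAddCommGroup Y] {u : ℕ → α → Y} {w : α → Y} {C : ℝ}
    (hu : ∀ j, AEStronglyMeasurable (u j) μ) (hC : ∀ j x, ‖u j x‖ ≤ C)
    (hl : ∀ᵐ x ∂μ, Tendsto (fun j => u j x) atTop (𝓝 (w x))) :
    Tendsto (fun j => eLpNorm (u j - w) 1 μ) atTop (𝓝 0) := by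
  have h := tendsto_lintegral_norm_of_dominated_convergence hu (hasFiniteIntegral_const C)
    (fun j => Eventually.of_forall (hC j)) hl
  refine h.congr fun j => ?_
  rw [eLpNorm_one_eq_lintegral_enorm]
  simp only [ofReal_norm, Pi.sub_apply]

section Lipschitz

variable {n : ℕ} {F : Type*} [NormedAddCommGroup F] [NormedSpace ℝ F]
  {ψ : EuclideanSpace ℝ (Fin n) → ℝ} {K : NNReal}

/-- By Rademacher's theorem the line derivative agrees almost everywhere with the Fréchet
derivative, so the classical gradient is the weak one. -/
theorem integral_fderiv_smul_of_lipschitzWith (hψ : LipschitzWith K ψ)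
    {θ : EuclideanSpace ℝ (Fin n) → ℝ} (hθ : ContDiff ℝ (⊤ : ℕ∞) θ) (hθc : HasCompactSupport θ)
    (v : EuclideanSpace ℝ (Fin n)) :
    ∫ x, fderiv ℝ θ x v • ψ x = -∫ x, θ x • fderiv ℝ ψ x v := by
  obtain ⟨D, hD⟩ := (hθ.of_le (by simp)).lipschitzWith_of_hasCompactSupport hθc one_ne_zero
  have h := hψ.integral_lineDeriv_mul_eq (μ := volume) hD hθc v
  have e1 : ∫ x, lineDeriv ℝ ψ x v * θ x = ∫ x, θ x • fderiv ℝ ψ x v := by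
    refine integral_congr_ae ?_
    filter_upwards [hψ.ae_differentiableAt (μ := volume)] with x hx
    rw [hx.lineDeriv_eq_fderiv, smul_eq_mul, mul_comm]
  have e2 : ∫ x, lineDeriv ℝ θ x (-v) * ψ x = -∫ x, fderiv ℝ θ x v • ψ x := by
    rw [← integral_neg]
    congr 1
    funext x
    rw [((hθ.differentiable (by simp)).differentiableAt (x := x)).lineDeriv_eq_fderiv, map_neg,
      smul_eq_mul, neg_mul]
  rw [← e1, h, e2, neg_neg]

theorem fderiv_eq_zero_of_lt_norm {r : ℝ} (hr : ∀ x, r < ‖x‖ → ψ x = 0)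
    {x : EuclideanSpace ℝ (Fin n)} (hx : r < ‖x‖) : fderiv ℝ ψ x = 0 := by
  have h : ψ =ᶠ[𝓝 x] fun _ => 0 := by
    filter_upwards [(isOpen_lt continuous_const continuous_norm).mem_nhds hx] with y hy
    exact hr y hy
  rw [h.fderiv_eq, fderiv_fun_const]
  rfl

theorem locallyIntegrable_fderiv (hψ : LipschitzWith K ψ) : LocallyIntegrable (fderiv ℝ ψ) := by
  refine (locallyIntegrable_const (K : ℝ)).mono
    (measurable_fderiv ℝ ψ).aestronglyMeasurable (Eventually.of_forall fun x => ?_)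
  rw [Real.norm_of_nonneg K.coe_nonneg]
  exact norm_fderiv_le_of_lipschitz ℝ hψ

theorem fderiv_mollify_of_lipschitzWith (hψ : LipschitzWith K ψ)
    (η : ContDiffBump (0 : EuclideanSpace ℝ (Fin n))) (x : EuclideanSpace ℝ (Fin n)) :
    fderiv ℝ (mollify η ψ) x = mollify η (fderiv ℝ ψ) x :=
  fderiv_mollify η hψ.continuous.locallyIntegrable (locallyIntegrable_fderiv hψ)
    (fun _ hθ hθc v => integral_fderiv_smul_of_lipschitzWith hψ hθ hθc v) x

theorem norm_le_of_eq_zero_off_ball (hψ : LipschitzWith K ψ) {r : ℝ}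
    (hr : ∀ x, r < ‖x‖ → ψ x = 0) : ∃ C, ∀ x, ‖ψ x‖ ≤ C := by
  refine hψ.continuous.bounded_above_of_compact_support
    (HasCompactSupport.of_support_subset_isCompact
      (isCompact_closedBall (0 : EuclideanSpace ℝ (Fin n)) r) fun x hx => ?_)
  by_contra h
  exact hx (hr x (by simpa using h))

/-- A compactly supported Lipschitz function times a constant vector is in `W₀^{1,∞}` of a large
ball. -/
theorem isW01_smul_const (hψ : LipschitzWith K ψ) {r : ℝ} (hr : ∀ x, r < ‖x‖ → ψ x = 0) (b : F) :
    IsW01 (Metric.ball 0 (r + 3)) (fun x => ψ x • b) (fun x => (fderiv ℝ ψ x).smulRight b) := by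
  obtain ⟨C, hC⟩ := norm_le_of_eq_zero_off_ball hψ hr
  have hfin : IsFiniteMeasure
      (volume.restrict (Metric.ball (0 : EuclideanSpace ℝ (Fin n)) (r + 3))) :=
    ⟨by simpa using measure_ball_lt_top⟩
  have hS : ∀ q : EuclideanSpace ℝ (Fin n) →L[ℝ] ℝ, ‖q.smulRight b‖ = ‖q‖ * ‖b‖ :=
    fun q => q.norm_smulRight_apply b
  have hScont : Continuous fun q : EuclideanSpace ℝ (Fin n) →L[ℝ] ℝ => q.smulRight b :=
    ((ContinuousLinearMap.smulRightL ℝ (EuclideanSpace ℝ (Fin n)) F).flip b).continuous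
  have hm : ∀ j, ContDiff ℝ (⊤ : ℕ∞) (mollify (bump n j) ψ) :=
    fun j => contDiff_mollify _ hψ.continuous.locallyIntegrable
  have hmd : ∀ j, fderiv ℝ (fun x => mollify (bump n j) ψ x • b) =
      fun x => (mollify (bump n j) (fderiv ℝ ψ) x).smulRight b := by
    intro j
    funext x
    rw [fderiv_smul_const ((hm j).differentiable (by simp)).differentiableAt,
      fderiv_mollify_of_lipschitzWith hψ]
  -- The mollified functions are supported in the closed ball of radius `r + 2`, which the open ball
  -- of radius `r + 3` contains.
  have hm0 : ∀ j x, r + 2 < ‖x‖ → mollify (bump n j) ψ x = 0 := fun j x hx =>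
    mollify_eq_zero _ hr (by linarith [bump_rOut_le n j])
  have hsub : ∀ j, Function.support (fun x => mollify (bump n j) ψ x • b) ⊆
      Metric.closedBall 0 (r + 2) := by
    intro j x hx
    by_contra h
    exact hx (by simp [hm0 j x (by simpa using h)])
  refine ⟨?_, ?_, fun j x => mollify (bump n j) ψ x • b, fun j => ⟨?_, ?_, ?_⟩, ?_, ?_⟩
  · refine memLp_top_of_bound (hψ.continuous.smul continuous_const).aestronglyMeasurable (C * ‖b‖)
      (Eventually.of_forall fun x => ?_)
    rw [norm_smul]
    exact mul_le_mul_of_nonneg_right (hC x) (norm_nonneg _)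
  · refine memLp_top_of_bound (hScont.comp_aestronglyMeasurable
      (measurable_fderiv ℝ ψ).aestronglyMeasurable) (K * ‖b‖) (Eventually.of_forall fun x => ?_)
    rw [hS]
    exact mul_le_mul_of_nonneg_right (norm_fderiv_le_of_lipschitz ℝ hψ) (norm_nonneg _)
  · exact (hm j).smul contDiff_const
  · exact HasCompactSupport.of_support_subset_isCompact (isCompact_closedBall 0 (r + 2)) (hsub j)
  · exact (closure_minimal (hsub j) Metric.isClosed_closedBall).trans
      (Metric.closedBall_subset_ball (by linarith))
  · refine tendsto_eLpNorm_one_of_bounded (C := C * ‖b‖)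
      (fun j => ((hm j).continuous.smul continuous_const).aestronglyMeasurable) (fun j x => ?_) ?_
    · rw [norm_smul]
      exact mul_le_mul_of_nonneg_right (norm_mollify_le _ (Eventually.of_forall hC) x)
        (norm_nonneg _)
    · filter_upwards [ae_restrict_of_ae (ae_tendsto_mollify hψ.continuous.locallyIntegrable)]
        with x hx
      exact hx.smul_const b
  · simp only [hmd]
    refine tendsto_eLpNorm_one_of_bounded (C := K * ‖b‖) (fun j => ?_) (fun j x => ?_) ?_
    · exact (hScont.comp (contDiff_mollify _
        (locallyIntegrable_fderiv hψ)).continuous).aestronglyMeasurable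
    · rw [hS]
      exact mul_le_mul_of_nonneg_right (norm_mollify_le _ (Eventually.of_forall fun x =>
        norm_fderiv_le_of_lipschitz ℝ hψ) x) (norm_nonneg _)
    · filter_upwards [ae_restrict_of_ae (ae_tendsto_mollify (locallyIntegrable_fderiv hψ))]
        with x hx
      exact (hScont.tendsto _).comp hx

theorem setIntegral_fderiv_smul_of_lipschitzWith [CompleteSpace F] (hψ : LipschitzWith K ψ) {r : ℝ}
    (hr : ∀ x, r < ‖x‖ → ψ x = 0) (b : F) {θ : EuclideanSpace ℝ (Fin n) → ℝ}
    (hθ : ContDiff ℝ (⊤ : ℕ∞) θ) (hθc : HasCompactSupport θ) (v : EuclideanSpace ℝ (Fin n)) :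
    ∫ x in Metric.ball 0 (r + 3), fderiv ℝ θ x v • (ψ x • b) =
      -∫ x in Metric.ball 0 (r + 3), θ x • (fderiv ℝ ψ x).smulRight b v := by
  have hout : ∀ x ∉ Metric.ball (0 : EuclideanSpace ℝ (Fin n)) (r + 3), r < ‖x‖ := by
    intro x hx
    have : r + 3 ≤ ‖x‖ := by simpa using hx
    linarith
  rw [setIntegral_eq_integral_of_forall_compl_eq_zero fun x hx => by simp [hr x (hout x hx)],
    setIntegral_eq_integral_of_forall_compl_eq_zero fun x hx => by
      simp [fderiv_eq_zero_of_lt_norm hr (hout x hx)]]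
  simp only [ContinuousLinearMap.smulRight_apply, ← smul_assoc]
  rw [integral_smul_const, integral_smul_const,
    integral_fderiv_smul_of_lipschitzWith hψ hθ hθc, neg_smul]

theorem isW01Infty_smul_const {s : ℕ} (hψ : LipschitzWith K ψ) {r : ℝ}
    (hr : ∀ x, r < ‖x‖ → ψ x = 0) (b : Form n s) :
    IsW01Infty (Metric.ball 0 (r + 3)) (fun x => ψ x • b)
      (fun x => (fderiv ℝ ψ x).smulRight b) :=
  have h := isW01_smul_const hψ hr b
  ⟨h.memLp, h.memLp_gradient,
    fun _ hθ hθc _ v => setIntegral_fderiv_smul_of_lipschitzWith hψ hr b hθ hθc v,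
    h.exists_approx⟩

end Lipschitz

end ExtForms

/-! ### Tent functions over parallelepipeds -/

namespace ExtForms

section Tent

variable {n : ℕ} (p : Fin n → EuclideanSpace ℝ (Fin n) →L[ℝ] ℝ)

/-- The tent function over the parallelepiped `maxᵢ |pᵢ| ≤ 1`. -/
noncomputable def tent (x : EuclideanSpace ℝ (Fin n)) : ℝ := max 0 (1 - ‖fun i => p i x‖)

/-- The pyramid over one of the faces of the parallelepiped `maxᵢ |pᵢ| ≤ 1`. -/
def pyramid (i : Fin n) : Set (EuclideanSpace ℝ (Fin n)) :=
  {x | p i x < 1 ∧ 0 < p i x ∧ ∀ j, j ≠ i → |p j x| < p i x}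

theorem exists_lipschitzWith_tent : ∃ K, LipschitzWith K (tent p) := by
  have h1 := lipschitzWith_one_norm.comp (ContinuousLinearMap.pi p).lipschitz
  exact ⟨_, ((LipschitzWith.const (1 : ℝ)).sub h1).const_max 0⟩

theorem isOpen_pyramid (i : Fin n) : IsOpen (pyramid p i) := by
  have h : pyramid p i = {x | p i x < 1} ∩
      ({x | 0 < p i x} ∩ ⋂ j, ⋂ (_ : j ≠ i), {x | |p j x| < p i x}) := by
    ext x
    simp [pyramid]
  rw [h]
  exact (isOpen_lt (p i).continuous continuous_const).inter
    ((isOpen_lt continuous_const (p i).continuous).inter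
      (isOpen_iInter_of_finite fun j => isOpen_iInter_of_finite fun _ =>
        isOpen_lt (p j).continuous.abs (p i).continuous))

variable {p}

theorem norm_eq_of_mem_pyramid {i : Fin n} {x : EuclideanSpace ℝ (Fin n)} (hx : x ∈ pyramid p i) :
    ‖fun j => p j x‖ = p i x := by
  refine le_antisymm ((pi_norm_le_iff_of_nonneg hx.2.1.le).mpr fun j => ?_) ?_
  · by_cases hj : j = i
    · rw [hj, Real.norm_of_nonneg hx.2.1.le]
    · exact (hx.2.2 j hj).le
  · exact (le_abs_self _).trans (norm_le_pi_norm (fun j => p j x) i)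

theorem fderiv_tent_of_mem_pyramid {i : Fin n} {x : EuclideanSpace ℝ (Fin n)}
    (hx : x ∈ pyramid p i) : fderiv ℝ (tent p) x = -p i := by
  have h : tent p =ᶠ[𝓝 x] fun y => 1 - p i y := by
    filter_upwards [(isOpen_pyramid p i).mem_nhds hx] with y hy
    rw [tent, norm_eq_of_mem_pyramid hy, max_eq_right (by linarith [hy.1])]
  rw [h.fderiv_eq, fderiv_const_sub, ContinuousLinearMap.fderiv]

theorem fderiv_tent_of_neg_mem_pyramid {i : Fin n} {x : EuclideanSpace ℝ (Fin n)}
    (hx : -x ∈ pyramid p i) : fderiv ℝ (tent p) x = p i := by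
  have h : tent p =ᶠ[𝓝 x] fun y => 1 + p i y := by
    filter_upwards [((isOpen_pyramid p i).preimage continuous_neg).mem_nhds hx] with y hy
    have h1 := norm_eq_of_mem_pyramid hy
    have h2 : (fun j => p j (-y)) = -fun j => p j y := funext fun j => map_neg _ _
    rw [h2, norm_neg, map_neg] at h1
    have h3 := hy.1
    rw [map_neg] at h3
    rw [tent, h1, sub_neg_eq_add, max_eq_right (by linarith)]
  rw [h.fderiv_eq, fderiv_const_add, ContinuousLinearMap.fderiv]

theorem fderiv_tent_of_one_lt {x : EuclideanSpace ℝ (Fin n)} (hx : 1 < ‖fun j => p j x‖) :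
    fderiv ℝ (tent p) x = 0 := by
  have h : tent p =ᶠ[𝓝 x] fun _ => 0 := by
    have ho : IsOpen {y | 1 < ‖fun j => p j y‖} :=
      isOpen_lt continuous_const (ContinuousLinearMap.pi p).continuous.norm
    filter_upwards [ho.mem_nhds hx] with y hy
    exact max_eq_left (sub_nonpos.mpr (le_of_lt hy))
  rw [h.fderiv_eq, fderiv_fun_const]
  rfl

theorem eq_of_mem_pyramid {i j : Fin n} {x : EuclideanSpace ℝ (Fin n)} (hi : x ∈ pyramid p i)
    (hj : x ∈ pyramid p j) : i = j := by
  by_contra h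
  have h1 := hi.2.2 j (Ne.symm h)
  have h2 := hj.2.2 i h
  linarith [le_abs_self (p i x), le_abs_self (p j x)]

theorem neg_notMem_pyramid {i j : Fin n} {x : EuclideanSpace ℝ (Fin n)} (hi : x ∈ pyramid p i) :
    -x ∉ pyramid p j := by
  intro hj
  by_cases h : i = j
  · subst h
    have := hj.2.1
    rw [map_neg] at this
    linarith [hi.2.1]
  · have h1 := hi.2.2 j (Ne.symm h)
    have h2 := hj.2.2 i h
    rw [map_neg, map_neg, abs_neg] at h2
    linarith [le_abs_self (p i x), neg_le_abs (p j x)]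

theorem sum_indicator_pyramid (a b : Fin n → ℝ) {i : Fin n} {x : EuclideanSpace ℝ (Fin n)}
    (hx : x ∈ pyramid p i) : ∑ j, ((pyramid p j).indicator (fun _ => a j) x +
      (pyramid p j).indicator (fun _ => b j) (-x)) = a i := by
  rw [Finset.sum_eq_single i, Set.indicator_of_mem hx,
    Set.indicator_of_notMem (neg_notMem_pyramid hx), add_zero]
  · intro j _ hj
    rw [Set.indicator_of_notMem fun h => hj (eq_of_mem_pyramid h hx),
      Set.indicator_of_notMem (neg_notMem_pyramid hx), add_zero]
  · simp

theorem volume_setOf_eq_zero {q : EuclideanSpace ℝ (Fin n) →L[ℝ] ℝ} (hq : q ≠ 0) (c : ℝ) :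
    ∀ᵐ x, q x ≠ c := by
  by_cases hx : ∃ x0, q x0 = c
  · obtain ⟨x0, hx0⟩ := hx
    have h := Measure.addHaar_affineSubspace volume (AffineSubspace.mk' x0 q.ker) (fun h => hq ?_)
    · refine measure_mono_null (fun x hx => ?_) h
      simp only [Set.mem_compl_iff, Set.mem_ofPred_eq, not_not] at hx
      simp [AffineSubspace.mem_mk', hx, hx0]
    · have h1 := congrArg AffineSubspace.direction h
      rw [AffineSubspace.direction_mk', AffineSubspace.direction_top] at h1
      ext x
      have : x ∈ q.ker := h1 ▸ Submodule.mem_top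
      simpa using this
  · exact Eventually.of_forall fun x h => hx ⟨x, h⟩

variable (hp : ∀ x, (∀ i, p i x = 0) → x = 0)
include hp

theorem exists_dual_vector (c : Fin n → ℝ) : ∃ x, ∀ i, p i x = c i := by
  let P : EuclideanSpace ℝ (Fin n) →ₗ[ℝ] (Fin n → ℝ) := LinearMap.pi fun i => (p i : _ →ₗ[ℝ] ℝ)
  have hP : Function.Injective P := by
    rw [← LinearMap.ker_eq_bot, LinearMap.ker_eq_bot']
    exact fun x hx => hp x fun i => congrFun hx i
  obtain ⟨x, hx⟩ := (LinearMap.injective_iff_surjective_of_finrank_eq_finrank (by simp)).mp hP c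
  exact ⟨x, fun i => congrFun hx i⟩

theorem exists_norm_le : ∃ r, ∀ x, r < ‖x‖ → 1 < ‖fun i => p i x‖ := by
  let P : EuclideanSpace ℝ (Fin n) →ₗ[ℝ] (Fin n → ℝ) := LinearMap.pi fun i => (p i : _ →ₗ[ℝ] ℝ)
  have hP : LinearMap.ker P = ⊥ := LinearMap.ker_eq_bot'.mpr fun x hx => hp x fun i => congrFun hx i
  obtain ⟨K, hK, h⟩ := P.exists_antilipschitzWith hP
  refine ⟨K, fun x hx => ?_⟩
  have h1 := h.le_mul_dist x 0
  rw [dist_zero_right, map_zero, dist_zero_right] at h1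
  by_contra h2
  have h3 : ‖P x‖ ≤ 1 := not_lt.mp h2
  nlinarith [K.coe_nonneg]

/-- The exceptional points lie on the finitely many hyperplanes `pᵢ = 0`, `pᵢ = ±1`, `pⱼ = ±pᵢ`,
which are null sets because the `pᵢ` form a basis. -/
theorem ae_mem_pyramid (hn : 0 < n) : ∀ᵐ x, (∃ i, x ∈ pyramid p i) ∨ (∃ i, -x ∈ pyramid p i) ∨
    1 < ‖fun i => p i x‖ := by
  have hne : ∀ (i : Fin n) (c : ℝ), ∀ j, j ≠ i → p j + c • p i ≠ 0 := by
    intro i c j hij h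
    obtain ⟨x, hx⟩ := exists_dual_vector hp (Pi.single j 1)
    have h1 := congrArg (fun q => q x) h
    simp [hx, Pi.single_eq_of_ne hij.symm] at h1
  have hne0 : ∀ i, p i ≠ 0 := by
    intro i h
    obtain ⟨x, hx⟩ := exists_dual_vector hp (Pi.single i 1)
    have h1 := hx i
    simp [h] at h1
  have e1 : ∀ᵐ x, ∀ i, p i x ≠ 0 := ae_all_iff.mpr fun i => volume_setOf_eq_zero (hne0 i) 0
  have e2 : ∀ᵐ x, ∀ i, p i x ≠ 1 := ae_all_iff.mpr fun i => volume_setOf_eq_zero (hne0 i) 1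
  have e3 : ∀ᵐ x, ∀ i, p i x ≠ -1 := ae_all_iff.mpr fun i => volume_setOf_eq_zero (hne0 i) (-1)
  have e4 : ∀ᵐ x, ∀ i j, j ≠ i → (p j + (1 : ℝ) • p i) x ≠ 0 :=
    ae_all_iff.mpr fun i => ae_all_iff.mpr fun j => by
      by_cases h : j = i
      · simp [h]
      · simpa [h] using volume_setOf_eq_zero (hne i 1 j h) 0
  have e5 : ∀ᵐ x, ∀ i j, j ≠ i → (p j + (-1 : ℝ) • p i) x ≠ 0 :=
    ae_all_iff.mpr fun i => ae_all_iff.mpr fun j => by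
      by_cases h : j = i
      · simp [h]
      · simpa [h] using volume_setOf_eq_zero (hne i (-1) j h) 0
  filter_upwards [e1, e2, e3, e4, e5] with x h1 h2 h3 h4 h5
  have : Nonempty (Fin n) := ⟨⟨0, hn⟩⟩
  obtain ⟨i, -, hi⟩ := Finset.exists_max_image Finset.univ (fun i => |p i x|) Finset.univ_nonempty
  have hlt : ∀ j, j ≠ i → |p j x| < |p i x| := by
    intro j hj
    refine lt_of_le_of_ne (hi j (Finset.mem_univ j)) fun h => ?_
    rcases abs_eq_abs.mp h with h | h
    · exact h5 i j hj (by simp [h])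
    · exact h4 i j hj (by simp [h])
  rcases lt_trichotomy |p i x| 1 with h | h | h
  · rcases lt_or_gt_of_ne (h1 i) with h0 | h0
    · refine Or.inr (Or.inl ⟨i, ?_⟩)
      rw [abs_of_neg h0] at h hlt
      refine ⟨by simpa using h, by simpa using h0, fun j hj => ?_⟩
      rw [map_neg, map_neg, abs_neg]
      exact hlt j hj
    · refine Or.inl ⟨i, ?_⟩
      rw [abs_of_pos h0] at h hlt
      exact ⟨h, h0, hlt⟩
  · rcases (abs_eq zero_le_one).mp h with h | h
    · exact absurd h (h2 i)
    · exact absurd h (h3 i)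
  · exact Or.inr (Or.inr (h.trans_le (norm_le_pi_norm (fun j => p j x) i)))

theorem volume_pyramid_pos (i : Fin n) : 0 < volume (pyramid p i) := by
  refine (isOpen_pyramid p i).measure_pos volume ?_
  obtain ⟨x, hx⟩ := exists_dual_vector hp (Pi.single i (1 / 2))
  refine ⟨x, ?_, ?_, fun j hj => ?_⟩
  · rw [hx, Pi.single_eq_same]; norm_num
  · rw [hx, Pi.single_eq_same]; norm_num
  · rw [hx, hx, Pi.single_eq_same, Pi.single_eq_of_ne hj]; norm_num

/-- The linear involution exchanging the coordinates `pᵢ` and `pⱼ` maps one pyramid onto the other,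
and its determinant is `±1`. -/
theorem volume_pyramid_eq (i j : Fin n) : volume (pyramid p i) = volume (pyramid p j) := by
  let P : EuclideanSpace ℝ (Fin n) →ₗ[ℝ] (Fin n → ℝ) := LinearMap.pi fun i => (p i : _ →ₗ[ℝ] ℝ)
  have hP : Function.Bijective P := by
    refine ⟨?_, fun c => ?_⟩
    · rw [← LinearMap.ker_eq_bot, LinearMap.ker_eq_bot']
      exact fun x hx => hp x fun i => congrFun hx i
    · obtain ⟨x, hx⟩ := exists_dual_vector hp c
      exact ⟨x, funext hx⟩
  let e := LinearEquiv.ofBijective P hP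
  let σ := Equiv.swap i j
  let T : EuclideanSpace ℝ (Fin n) →ₗ[ℝ] EuclideanSpace ℝ (Fin n) :=
    e.symm.toLinearMap ∘ₗ (LinearMap.funLeft ℝ ℝ σ) ∘ₗ e.toLinearMap
  have hT : ∀ l x, p l (T x) = p (σ l) x := by
    intro l x
    have h1 : e (T x) = LinearMap.funLeft ℝ ℝ σ (e x) := e.apply_symm_apply _
    exact congrFun h1 l
  have hTT : T ∘ₗ T = LinearMap.id := by
    ext1 x
    refine sub_eq_zero.mp (hp _ fun l => ?_)
    rw [map_sub, LinearMap.comp_apply, hT, hT, Equiv.swap_apply_self, LinearMap.id_apply, sub_self]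
  have hdet : LinearMap.det T * LinearMap.det T = 1 := by
    rw [← LinearMap.det_comp, hTT, LinearMap.det_id]
  have hpre : T ⁻¹' pyramid p j = pyramid p i := by
    ext x
    simp only [pyramid, Set.mem_preimage, Set.mem_ofPred_eq, hT]
    rw [show σ j = i from Equiv.swap_apply_right i j]
    refine and_congr_right fun _ => and_congr_right fun _ => ⟨fun h l hl => ?_, fun h l hl => ?_⟩
    · have := h (σ l) fun h' => hl (σ.injective (h'.trans (Equiv.swap_apply_left i j).symm))
      rwa [Equiv.swap_apply_self] at this
    · exact h (σ l) fun h' => hl (σ.injective (h'.trans (Equiv.swap_apply_right i j).symm))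
  have h1 : |(LinearMap.det T)⁻¹| = 1 := by
    rcases mul_self_eq_one_iff.mp hdet with h | h <;> simp [h]
  rw [← hpre, Measure.addHaar_preimage_linearMap volume (left_ne_zero_of_mul_eq_one hdet), h1]
  simp

/-- The mean value of a function of the gradient of the tent function. -/
theorem integral_comp_fderiv_tent (hn : 0 < n) {r : ℝ} (hr : ∀ x, r < ‖x‖ → 1 < ‖fun i => p i x‖)
    (H : (EuclideanSpace ℝ (Fin n) →L[ℝ] ℝ) → ℝ)
    (hH : ⨍ x in Metric.ball 0 (r + 3), H (fderiv ℝ (tent p) x) = H 0) :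
    ∑ i, (H (p i) + H (-p i) - 2 * H 0) = 0 := by
  have hin : ∀ i, ∀ x ∈ pyramid p i, ‖x‖ ≤ r := by
    intro i x hx
    by_contra h
    have := hr x (not_le.mp h)
    rw [norm_eq_of_mem_pyramid hx] at this
    linarith [hx.1]
  have hfin : ∀ i, volume (pyramid p i) ≠ ⊤ := fun i =>
    measure_ne_top_of_subset (show pyramid p i ⊆ Metric.closedBall 0 r from
      fun x hx => mem_closedBall_zero_iff.mpr (hin i x hx)) measure_closedBall_lt_top.ne
  -- Up to a null set, `g` is the deviation of `H (∇ tent)` from `H 0`: the gradient is `-pⱼ` on the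
  -- pyramid, `pⱼ` on its reflection, and zero outside.
  let g : EuclideanSpace ℝ (Fin n) → ℝ := fun x => ∑ j,
    ((pyramid p j).indicator (fun _ => H (-p j) - H 0) x +
      (pyramid p j).indicator (fun _ => H (p j) - H 0) (-x))
  have hae : ∀ᵐ x, H (fderiv ℝ (tent p) x) = g x + H 0 := by
    filter_upwards [ae_mem_pyramid hp hn] with x hx
    rcases hx with ⟨i, hi⟩ | ⟨i, hi⟩ | h
    · rw [fderiv_tent_of_mem_pyramid hi, show g x = _ from sum_indicator_pyramid _ _ hi]
      ring
    · have h1 : g x = H (p i) - H 0 := by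
        rw [← sum_indicator_pyramid (fun j => H (p j) - H 0) (fun j => H (-p j) - H 0) hi]
        refine Finset.sum_congr rfl fun j _ => ?_
        rw [neg_neg, add_comm]
      rw [fderiv_tent_of_neg_mem_pyramid hi, h1]
      ring
    · have h1 : g x = 0 := by
        refine Finset.sum_eq_zero fun j _ => ?_
        rw [Set.indicator_of_notMem, Set.indicator_of_notMem, add_zero]
        · intro hj
          have h2 := norm_eq_of_mem_pyramid hj
          have h3 : (fun j => p j (-x)) = -fun j => p j x := funext fun j => map_neg _ _
          rw [h3, norm_neg] at h2
          linarith [hj.1]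
        · intro hj
          linarith [hj.1, norm_eq_of_mem_pyramid hj]
      rw [fderiv_tent_of_one_lt h, h1, zero_add]
  have hi1 : ∀ j (a : ℝ), Integrable ((pyramid p j).indicator fun _ => a) := fun j a =>
    (integrable_indicator_iff (isOpen_pyramid p j).measurableSet).mpr (integrableOn_const (hfin j))
  have hgi : Integrable g :=
    integrable_finsetSum _ fun j _ => (hi1 j _).add (hi1 j _).comp_neg
  have hg : ∫ x, g x = ∑ j, volume.real (pyramid p j) * (H (p j) + H (-p j) - 2 * H 0) := by
    refine (integral_finsetSum _ fun j _ => (hi1 j _).add (hi1 j _).comp_neg).trans ?_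
    refine Finset.sum_congr rfl fun j _ => ?_
    rw [integral_add' (hi1 j _) (hi1 j _).comp_neg,
      integral_neg_eq_self ((pyramid p j).indicator fun _ => H (p j) - H 0),
      integral_indicator_const _ (isOpen_pyramid p j).measurableSet,
      integral_indicator_const _ (isOpen_pyramid p j).measurableSet]
    simp only [smul_eq_mul]
    ring
  have hball : volume (Metric.ball (0 : EuclideanSpace ℝ (Fin n)) (r + 3)) ≠ ⊤ :=
    measure_ball_lt_top.ne
  have i0 : Fin n := ⟨0, hn⟩
  have hr0 : 0 ≤ r := by
    obtain ⟨x, hx⟩ := MeasureTheory.nonempty_of_measure_ne_zero (volume_pyramid_pos hp i0).ne'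
    exact (norm_nonneg x).trans (hin i0 x hx)
  have hball0 : volume.real (Metric.ball (0 : EuclideanSpace ℝ (Fin n)) (r + 3)) ≠ 0 :=
    ENNReal.toReal_ne_zero.mpr ⟨(Metric.measure_ball_pos volume 0 (by linarith)).ne', hball⟩
  have hz : ∫ x, g x = 0 := by
    rw [average_eq, integral_congr_ae (ae_restrict_of_ae hae),
      integral_add hgi.integrableOn (integrableOn_const hball),
      setIntegral_eq_integral_of_forall_compl_eq_zero, setIntegral_const, smul_add,
      measureReal_restrict_apply_univ, smul_smul, inv_mul_cancel₀ hball0, one_smul,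
      add_eq_right, smul_eq_zero] at hH
    · exact hH.resolve_left (inv_ne_zero hball0)
    · intro x hx
      have hx' : r + 3 ≤ ‖x‖ := by simpa using hx
      refine Finset.sum_eq_zero fun j _ => ?_
      rw [Set.indicator_of_notMem, Set.indicator_of_notMem, add_zero]
      · intro hj
        have := hin j _ hj
        rw [norm_neg] at this
        linarith
      · intro hj
        linarith [hin j _ hj]
  have hV : volume.real (pyramid p i0) ≠ 0 :=
    ENNReal.toReal_ne_zero.mpr ⟨(volume_pyramid_pos hp i0).ne', hfin i0⟩
  have hall : ∀ j, volume.real (pyramid p j) = volume.real (pyramid p i0) := fun j => by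
    rw [Measure.real, volume_pyramid_eq hp j i0, Measure.real]
  rw [hg] at hz
  simp only [hall, ← Finset.mul_sum] at hz
  exact (mul_eq_zero.mp hz).resolve_left hV

end Tent

end ExtForms

/-! ### From mean values to affinity: (ii) ⇒ (iii) -/

namespace ExtForms

section Midpoint

variable {n : ℕ}

/-- Replacing `pᵢ` by `pᵢ + pⱼ` keeps a basis, so `Q(pᵢ + pⱼ) = Q(pᵢ)`, and by symmetry also
`Q(pⱼ)`. All the values are then equal, and their sum is zero. -/
theorem apply_update_eq_zero_of_sum_eq_zero {Q : (EuclideanSpace ℝ (Fin n) →L[ℝ] ℝ) → ℝ}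
    (hQ : ∀ p : Fin n → EuclideanSpace ℝ (Fin n) →L[ℝ] ℝ, (∀ x, (∀ i, p i x = 0) → x = 0) →
      ∑ i, Q (p i) = 0) {p : Fin n → EuclideanSpace ℝ (Fin n) →L[ℝ] ℝ}
    (hp : ∀ x, (∀ i, p i x = 0) → x = 0) (i : Fin n) : Q (p i) = 0 := by
  have key : ∀ i j, i ≠ j → Q (p i + p j) = Q (p i) := by
    intro i j hij
    have h1 := hQ (Function.update p i (p i + p j)) fun x hx => hp x fun l => by
      have hj := hx j
      rw [Function.update_of_ne hij.symm] at hj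
      by_cases hl : l = i
      · have hi := hx i
        rw [Function.update_self, add_apply, hj, add_zero] at hi
        rw [hl, hi]
      · have := hx l
        rwa [Function.update_of_ne hl] at this
    have h2 := hQ p hp
    rw [← Finset.add_sum_erase _ _ (Finset.mem_univ i)] at h1 h2
    rw [Function.update_self, Finset.sum_congr rfl fun l hl => by
      rw [Function.update_of_ne (Finset.ne_of_mem_erase hl)]] at h1
    linarith
  have hall : ∀ j, Q (p j) = Q (p i) := by
    intro j
    by_cases hij : j = i
    · rw [hij]
    · rw [← key i j (Ne.symm hij), ← key j i hij, add_comm]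
  have h := hQ p hp
  simp only [hall, Finset.sum_const, Finset.card_univ, Fintype.card_fin, nsmul_eq_mul] at h
  have : (n : ℝ) ≠ 0 := Nat.cast_ne_zero.mpr (Fin.pos i).ne'
  exact (mul_eq_zero.mp h).resolve_left this

/-- A coordinate covector along which `v` has a nonzero component is exchanged for `v`. -/
theorem exists_separating_family {v : EuclideanSpace ℝ (Fin n) →L[ℝ] ℝ} (hv : v ≠ 0) :
    ∃ (p : Fin n → EuclideanSpace ℝ (Fin n) →L[ℝ] ℝ) (i : Fin n),
      (∀ x, (∀ i, p i x = 0) → x = 0) ∧ p i = v := by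
  have h : ∃ i, v (EuclideanSpace.single i 1) ≠ 0 := by
    by_contra! h
    apply hv
    refine ContinuousLinearMap.coe_injective ((EuclideanSpace.basisFun (Fin n) ℝ).toBasis.ext fun i => ?_)
    simpa using h i
  obtain ⟨i, hi⟩ := h
  refine ⟨Function.update (fun j => EuclideanSpace.proj j) i v, i, fun x hx => ?_,
    Function.update_self ..⟩
  have h1 : ∀ j, j ≠ i → x j = 0 := by
    intro j hj
    have := hx j
    rwa [Function.update_of_ne hj] at this
  have h2 : x = x i • EuclideanSpace.single i 1 := by
    ext j
    by_cases hj : j = i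
    · subst hj; simp
    · simp [h1 j hj, hj]
  have h3 := hx i
  rw [Function.update_self, h2, map_smul, smul_eq_mul] at h3
  rw [h2, (mul_eq_zero.mp h3).resolve_right hi, zero_smul]

end Midpoint

/-- The midpoint identity makes `g - g 0` additive, and a measurable additive function on `ℝ` is
continuous, hence linear. -/
theorem exists_affine_of_midpoint {g : ℝ → ℝ} (hg : Measurable g)
    (h : ∀ s t, g (s + t) + g (s - t) = 2 * g s) : ∃ A : ℝ →ᵃ[ℝ] ℝ, ∀ t, g t = A t := by
  have hd : ∀ s t, g (s + t) - g 0 = (g s - g 0) + (g t - g 0) := by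
    intro s t
    have h1 := h ((s + t) / 2) ((s - t) / 2)
    have h2 := h ((s + t) / 2) ((s + t) / 2)
    ring_nf at h1 h2 ⊢
    linarith
  let L : ℝ →+ ℝ := AddMonoidHom.mk' (fun t => g t - g 0) hd
  have hL : Continuous L := MeasureTheory.Measure.AddMonoidHom.continuous_of_measurable L (hg.sub_const _)
  refine ⟨(L.toRealLinearMap hL).toLinearMap.toAffineMap + AffineMap.const ℝ ℝ (g 0), fun t => ?_⟩
  change g t = (g t - g 0) + g 0
  ring

/-- A quasiaffine function is midpoint affine in the directions `v ∧ β`. -/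
theorem VectoriallyExtQuasiaffine.midpoint {n m : ℕ} {k : Fin m → ℕ} {hk : ∀ i, 1 ≤ k i}
    {f : ((i : Fin m) → Form n (k i)) → ℝ} (hf : VectoriallyExtQuasiaffine k hk f)
    (ξ : (i : Fin m) → Form n (k i)) (β : (i : Fin m) → Form n (k i - 1))
    (v : EuclideanSpace ℝ (Fin n) →L[ℝ] ℝ) :
    f (ξ + extDeriv' hk (v.smulRight β)) + f (ξ - extDeriv' hk (v.smulRight β)) = 2 * f ξ := by
  let H : (EuclideanSpace ℝ (Fin n) →L[ℝ] ℝ) → ℝ := fun q => f (ξ + extDeriv' hk (q.smulRight β))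
  have hneg : ∀ q : EuclideanSpace ℝ (Fin n) →L[ℝ] ℝ,
      extDeriv' hk ((-q).smulRight β) = -extDeriv' hk (q.smulRight β) := by
    intro q
    rw [← map_neg]
    congr 1
    ext x
    simp
  have h0 : H 0 = f ξ := by
    have : (0 : EuclideanSpace ℝ (Fin n) →L[ℝ] ℝ).smulRight β = 0 := by
      ext x
      simp
    simp only [H, this, map_zero, add_zero]
  by_cases hv : v = 0
  · subst hv
    have h1 := hneg 0
    rw [neg_zero] at h1
    rw [sub_eq_add_neg, ← h1]
    change H 0 + H 0 = _
    rw [h0]; ring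
  obtain ⟨p, i, hp, hpi⟩ := exists_separating_family hv
  have hQ : ∀ p : Fin n → EuclideanSpace ℝ (Fin n) →L[ℝ] ℝ, (∀ x, (∀ i, p i x = 0) → x = 0) →
      ∑ i, (H (p i) + H (-p i) - 2 * H 0) = 0 := by
    intro p hp
    obtain ⟨r, hr⟩ := exists_norm_le hp
    obtain ⟨K, hK⟩ := exists_lipschitzWith_tent p
    -- The radius `r` may be negative; `|r|` ensures that the ball contains the origin.
    have hr0 : ∀ x, |r| < ‖x‖ → 1 < ‖fun i => p i x‖ := fun x hx =>
      hr x ((le_abs_self r).trans_lt hx)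
    have ht : ∀ x, |r| < ‖x‖ → tent p x = 0 := fun x hx =>
      max_eq_left (sub_nonpos.mpr (hr0 x hx).le)
    refine integral_comp_fderiv_tent hp (Fin.pos i) hr0 H ?_
    rw [h0]
    -- All components of the test field share one scalar tent, so every slot is moved along the same
    -- covector simultaneously.
    exact hf.2.2 (Metric.ball 0 (|r| + 3)) Metric.isOpen_ball Metric.isBounded_ball
      ⟨0, Metric.mem_ball_self (by positivity)⟩ ξ (fun i x => tent p x • β i)
      (fun i x => (fderiv ℝ (tent p) x).smulRight (β i)) fun i => isW01Infty_smul_const hK ht (β i)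
  have h1 := apply_update_eq_zero_of_sum_eq_zero
    (Q := fun q => H q + H (-q) - 2 * H 0) hQ hp i
  rw [hpi] at h1
  rw [sub_eq_add_neg, ← hneg, ← h0]
  exact sub_eq_zero.mp h1

theorem oneAffine_of_quasiaffine {n m : ℕ} {k : Fin m → ℕ} {hk : ∀ i, 1 ≤ k i}
    {f : ((i : Fin m) → Form n (k i)) → ℝ} (hf : VectoriallyExtQuasiaffine k hk f) :
    VectoriallyExtOneAffine k hk f := by
  intro ξ a β
  obtain ⟨p, rfl⟩ := exists_covectorForm_eq a
  have hw := extDeriv'_smulRight hk p β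
  set w := extDeriv' hk (p.smulRight β) with hw'
  have hsmul : ∀ t : ℝ, extDeriv' hk ((t • p).smulRight β) = t • w := by
    intro t
    rw [hw', ← map_smul]
    congr 1
    ext x
    simp [mul_smul]
  have hmeas : Measurable fun t : ℝ => f (ξ + t • w) := by
    borelize ((i : Fin m) → Form n (k i))
    exact Measurable.comp hf.1 (continuous_const.add (continuous_id.smul continuous_const)).measurable
  obtain ⟨A, hA⟩ := exists_affine_of_midpoint hmeas fun s t => by
    have h := hf.midpoint (ξ + s • w) β (t • p)
    rw [hsmul] at h
    have e1 : (s + t) • w = s • w + t • w := add_smul s t w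
    have e2 : (s - t) • w = s • w - t • w := sub_smul s t w
    rw [← h, e1, e2, add_assoc, add_sub_assoc]
  refine ⟨A, fun t => ?_⟩
  rw [← hA, hw]
  rfl

end ExtForms

theorem mainTheorem1 (n m : ℕ) (hm : 1 ≤ m) (k : Fin m → ℕ) (hk : ∀ i, 1 ≤ k i)
    (hkn : ∀ i, k i ≤ n) (f : ((i : Fin m) → ExtForms.Form n (k i)) → ℝ) :
    List.TFAE [
      ExtForms.VectoriallyExtPolyaffine k f,
      ExtForms.VectoriallyExtQuasiaffine k hk f,
      ExtForms.VectoriallyExtOneAffine k hk f,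
      ∃ c : (α : Fin m → ℕ) → ExtForms.Form n (∑ i, k i * α i),
        ∀ ξ : (i : Fin m) → ExtForms.Form n (k i),
          f ξ = ∑ α ∈ ExtForms.multiIndices n k,
            ExtForms.pairing (c α) (ExtForms.multiWedge ξ α)] := by
  tfae_have 1 ↔ 4 := ExtForms.polyaffine_iff_pairing hk f
  tfae_have 4 → 3 := fun ⟨_, hc⟩ => ExtForms.oneAffine_of_pairing hk hc
  tfae_have 3 → 4 := ExtForms.exists_pairing_of_oneAffine
  -- Smoothness of `f` is available only through the explicit formula.
  tfae_have 3 → 2 := fun h => by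
    obtain ⟨_, hc⟩ := ExtForms.exists_pairing_of_oneAffine h
    exact ExtForms.quasiaffine_of_contDiff hk (ExtForms.contDiff_of_pairing hc) h
  tfae_have 2 → 3 := ExtForms.oneAffine_of_quasiaffine
  tfae_finish
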